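/- \textbf{Setting.} Let $\mathcal V=\{1,\dots,n\}$ be the nodes of a directed graph $\mathcal G$ and let $\mathcal C\subseteq\{\mathcal S\subseteq\mathcal V:|\mathcal S|\le K\}$, $K\le n$, be a collection of feasible seed sets. A diffusion model $\mathcal D$ consists of a random vector ${\bf w}\sim\mathbb P$ and of indicators $\mathbb 1(\mathcal S,v,\mathcal D({\bf w}))\in\{0,1\}$ (node $v$ is influenced under seed set $\mathcal S$ and realization ${\bf w}$). Put $F(\mathcal S,v)=\mathbb E[\mathbb 1(\mathcal S,v,\mathcal D({\bf w}))]$, $F(\mathcal S)=\sum_v F(\mathcal S,v)$ and $p^*_{u,v}=F(\{u\},v)$. For $p:\mathcal V\times\mathcal V\to[0,1]$ put $f(\mathcal S,p)=\sum_{v}\max_{u\in\mathcal S}p_{u,v}$ (the maximum over $\emptyset$ being $0$). Let $\mathcal S^*\in\arg\max_{\mathcal S\in\mathcal C}F(\mathcal S)$, $\tilde{\mathcal S}\in\arg\max_{\mathcal S\in\mathcal C}f(\mathcal S,p^*)$ and $\rho=f(\tilde{\mathcal S},p^*)/F(\mathcal S^*)$, and assume $\rho>0$. For $\alpha\in(0,1]$,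 an $\alpha$-approximation oracle is a map $p\mapsto{\tt ORACLE}(\mathcal G,\mathcal C,p)\in\mathcal C$ with $f({\tt ORACLE}(\mathcal G,\mathcal C,p),p)\ge\alpha\max_{\mathcal S\in\mathcal C}f(\mathcal S,p)$ for all $p:\mathcal V\times\mathcal V\to[0,1]$. \textbf{Algorithm.} Given a feature matrix $X\in\mathbb R^{d\times n}$ with columns $x_v$, an oracle, and parameters $c,\lambda,\sigma>0$, DILinUCB starts with $\Sigma_{u,0}=\lambda I_d$, $b_{u,0}=0$, $\hat\theta_{u,0}=0$ and $\bar p_{u,v}=1$ for all $u,v$. In round $t=1,2,\dots$ it plays $\mathcal S_t={\tt ORACLE}(\mathcal G,\mathcal C,\bar p)$; an independent ${\bf w}_t\sim\mathbb P$ is drawn, and for every $u\in\mathcal S_t$ the vector $y_{u,t}=(\mathbb 1(\{u\},v,\mathcal D({\bf w}_t)))_{v}$ is observed. For every $u\in\mathcal S_t$ it sets $b_{u,t}=b_{u,t-1}+Xy_{u,t}$, $\Sigma_{u,t}=\Sigma_{u,t-1}+\sigma^{-2}XX^\top$, $\hat\theta_{u,t}=\sigma^{-2}\Sigma_{u,t}^{-1}b_{u,t}$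 and, for all $v$, $\bar p_{u,v}=\mathrm{Proj}_{[0,1]}\big[\langle\hat\theta_{u,t},x_v\rangle+c\sqrt{x_v^\top\Sigma_{u,t}^{-1}x_v}\big]$; nothing changes for $u\notin\mathcal S_t$. Its $\kappa$-scaled cumulative regret is $R^\kappa(T)=T\,F(\mathcal S^*)-\frac1\kappa\,\mathbb E\big[\sum_{t=1}^TF(\mathcal S_t)\big]$. \textbf{Theorem.} Assume that (1) $F(\mathcal S_1,v)\le F(\mathcal S_2,v)$ for all $v\in\mathcal V$ and $\mathcal S_1\subseteq\mathcal S_2\subseteq\mathcal V$; (2) there are $\theta^*_u\in\mathbb R^d$ ($u\in\mathcal V$) with $p^*_{u,v}=\langle\theta^*_u,x_v\rangle$ for all $u,v\in\mathcal V$; (3) $\|x_v\|_2\le1$ for all $v\in\mathcal V$. Then for all $\lambda,\sigma>0$, every $\alpha$-approximation oracle and every $$c\ \ge\ \frac1\sigma\sqrt{dn\log\Big(1+\frac{nT}{\sigma^2\lambda d}\Big)+2\log(n^2T)}+\sqrt\lambda\,\max_{u\in\mathcal V}\|\theta^*_u\|_2,$$ the $\rho\alpha$-scaled cumulative regret of DILinUCB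 satisfies $$R^{\rho\alpha}(T)\ \le\ \frac{2c}{\rho\alpha}\,n^{3/2}\sqrt{\frac{dKT\log\big(1+\frac{nT}{d\lambda\sigma^2}\big)}{\lambda\log\big(1+\frac1{\lambda\sigma^2}\big)}}+\frac1\rho .$$ In the tabular case, where $d=n$ and $X=I$, $$R^{\rho\alpha}(T)\ \le\ \frac{2c}{\rho\alpha}\,n^{3/2}\sqrt{\frac{KT\log\big(1+\frac{T}{\lambda\sigma^2}\big)}{\lambda\log\big(1+\frac1{\lambda\sigma^2}\big)}}+\frac1\rho .$$ -/

import Mathlib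

open MeasureTheory ProbabilityTheory

namespace IMBandit

/-- A diffusion model on the nodes `Fin n`: all its randomness is a diffusion random vector `w : W`
with law `law`; given `w`, the set of nodes influenced by a seed set `S` is deterministic. -/
structure DiffusionModel (n : ℕ) (W : Type*) [MeasurableSpace W] where
  /-- the law of the diffusion random vector -/
  law : Measure W
  isProbabilityMeasure : IsProbabilityMeasure law
  /-- the nodes influenced by a seed set under a realization of the diffusion -/
  influenced : Finset (Fin n) → W → Finset (Fin n)
  measurableSet_influenced : ∀ (S : Finset (Fin n)) (v : Fin n),
    MeasurableSet {w | v ∈ influenced S w}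

namespace DiffusionModel

variable {n : ℕ} {W : Type*} [MeasurableSpace W] (D : DiffusionModel n W)

/-- The indicator that `v` is influenced under the seed set `S` and the realization `w`. -/
noncomputable def reach (S : Finset (Fin n)) (v : Fin n) (w : W) : ℝ :=
  if v ∈ D.influenced S w then 1 else 0

/-- `F(S, v)`: the probability that `v` is influenced under the seed set `S`. -/
noncomputable def influenceProb (S : Finset (Fin n)) (v : Fin n) : ℝ :=
  ∫ w, D.reach S v w ∂D.law

/-- `F(S)`: the expected number of influenced nodes. -/
noncomputable def spread (S : Finset (Fin n)) : ℝ :=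
  ∑ v, D.influenceProb S v

/-- `F(S, v)` is monotone in `S`, for every node `v`. -/
def IsMonotone : Prop :=
  ∀ (v : Fin n) (S₁ S₂ : Finset (Fin n)), S₁ ⊆ S₂ → D.influenceProb S₁ v ≤ D.influenceProb S₂ v

/-- `p*(u, v) = F({u}, v)`: the pairwise reachability from `u` to `v`. -/
noncomputable def pairwiseReach (u v : Fin n) : ℝ :=
  D.influenceProb {u} v

end DiffusionModel

/-- An influence maximization problem: a directed graph, a collection of feasible seed sets and a
diffusion model. -/
structure IMProblem (n : ℕ) (W : Type*) [MeasurableSpace W] where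
  graph : Digraph (Fin n)
  feasible : Finset (Finset (Fin n))
  diffusion : DiffusionModel n W

/-- `f(S, p) = ∑ v, max_{u ∈ S} p(u, v)`, with maximum `0` over the empty set. -/
noncomputable def surrogate {n : ℕ} (S : Finset (Fin n)) (p : Fin n → Fin n → ℝ) : ℝ :=
  ∑ v, if h : S.Nonempty then S.sup' h (fun u => p u v) else 0

/-- `S` maximizes the objective `g` over the collection `C`. -/
def IsArgmax {n : ℕ} (C : Finset (Finset (Fin n))) (g : Finset (Fin n) → ℝ)
    (S : Finset (Fin n)) : Prop :=
  S ∈ C ∧ ∀ S' ∈ C, g S' ≤ g S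

/-- An oracle maps a graph, a collection of feasible sets and pairwise probabilities to a set. -/
abbrev Oracle (n : ℕ) : Type :=
  Digraph (Fin n) → Finset (Finset (Fin n)) → (Fin n → Fin n → ℝ) → Finset (Fin n)

/-- On the graph `G` and the collection `C`, the oracle returns feasible sets and is an
`α`-approximation algorithm for the maximization of `f(·, p)`, for all `[0,1]`-valued `p`. -/
def IsApproxOracle {n : ℕ} (oracle : Oracle n) (G : Digraph (Fin n))
    (C : Finset (Finset (Fin n))) (α : ℝ) : Prop :=
  ∀ p : Fin n → Fin n → ℝ, (∀ u v, p u v ∈ Set.Icc (0 : ℝ) 1) →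
    oracle G C p ∈ C ∧ ∀ S ∈ C, α * surrogate S p ≤ surrogate (oracle G C p) p

/-- The target feature `x_v`, the `v`-th column of `X`, as a Euclidean vector. -/
def feature {n d : ℕ} (X : Matrix (Fin d) (Fin n) ℝ) (v : Fin n) : EuclideanSpace ℝ (Fin d) :=
  WithLp.toLp 2 (fun i => X i v)

/-- The variables maintained by DILinUCB. -/
structure State (n d : ℕ) where
  /-- the Gram matrices -/
  gram : Fin n → Matrix (Fin d) (Fin d) ℝ
  /-- the vectors summarizing the past feedback -/
  b : Fin n → Fin d → ℝ
  /-- the source weight estimates -/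
  theta : Fin n → Fin d → ℝ
  /-- the upper confidence bounds used by the oracle -/
  ucb : Fin n → Fin n → ℝ

/-- The initialization of DILinUCB. -/
def initState (n d : ℕ) (lam : ℝ) : State n d where
  gram _ := lam • (1 : Matrix (Fin d) (Fin d) ℝ)
  b _ := 0
  theta _ := 0
  ucb _ _ := 1

/-- The update of DILinUCB after the seed set `S` is played, where `y u` is the pairwise influence
feedback of the source `u`; only the variables of the sources `u ∈ S` change. -/
noncomputable def update {n d : ℕ} (X : Matrix (Fin d) (Fin n) ℝ) (c σ : ℝ)
    (S : Finset (Fin n)) (y : Fin n → Fin n → ℝ) (s : State n d) : State n d :=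
  let gram : Fin n → Matrix (Fin d) (Fin d) ℝ := fun u =>
    if u ∈ S then s.gram u + (σ ^ 2)⁻¹ • (X * X.transpose) else s.gram u
  let b : Fin n → Fin d → ℝ := fun u =>
    if u ∈ S then s.b u + X.mulVec (y u) else s.b u
  let theta : Fin n → Fin d → ℝ := fun u =>
    if u ∈ S then (σ ^ 2)⁻¹ • ((gram u)⁻¹).mulVec (b u) else s.theta u
  let ucb : Fin n → Fin n → ℝ := fun u v =>
    if u ∈ S then
      let x : Fin d → ℝ := fun i => X i v
      (Set.projIcc (0 : ℝ) 1 zero_le_one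
        (dotProduct (theta u) x + c * Real.sqrt (dotProduct x (((gram u)⁻¹).mulVec x))) : ℝ)
    else s.ucb u v
  { gram := gram, b := b, theta := theta, ucb := ucb }

section Run

variable {n d : ℕ} {W : Type*} [MeasurableSpace W]

/-- The variables of DILinUCB after `t` rounds, when the diffusion random vectors of the successive
rounds are `w 0, w 1, …`. -/
noncomputable def stateAfter (P : IMProblem n W) (oracle : Oracle n)
    (X : Matrix (Fin d) (Fin n) ℝ) (c lam σ : ℝ) (w : ℕ → W) : ℕ → State n d
  | 0 => initState n d lam
  | t + 1 =>
    let s := stateAfter P oracle X c lam σ w t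
    update X c σ (oracle P.graph P.feasible s.ucb)
      (fun u v => P.diffusion.reach {u} v (w t)) s

/-- The seed set chosen by DILinUCB after `t` completed rounds, i.e. in the round whose diffusion
random vector is `w t`. -/
noncomputable def seedSet (P : IMProblem n W) (oracle : Oracle n)
    (X : Matrix (Fin d) (Fin n) ℝ) (c lam σ : ℝ) (w : ℕ → W) (t : ℕ) : Finset (Fin n) :=
  oracle P.graph P.feasible (stateAfter P oracle X c lam σ w t).ucb

end Run

/-- The total expected spread `∑ F(S_t)` of the random sets chosen in the first `T` rounds. -/
noncomputable def totalSpread {n : ℕ} {W Ω : Type*} [MeasurableSpace W] (P : IMProblem n W)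
    (S : ℕ → Ω → Finset (Fin n)) (T : ℕ) (ω : Ω) : ℝ :=
  ∑ t ∈ Finset.range T, P.diffusion.spread (S t ω)

/-- The `κ`-scaled cumulative regret in the first `T` rounds, `Sstar` being an optimal seed set. -/
noncomputable def scaledRegret {n : ℕ} {W Ω : Type*} [MeasurableSpace W] [MeasurableSpace Ω]
    (P : IMProblem n W) (μ : Measure Ω) (S : ℕ → Ω → Finset (Fin n)) (Sstar : Finset (Fin n))
    (κ : ℝ) (T : ℕ) : ℝ :=
  T * P.diffusion.spread Sstar - 1 / κ * ∫ ω, totalSpread P S T ω ∂μ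

end IMBandit

/-! ### Concavity inequalities for the logarithm -/

namespace IMBandit

/-! Write m = λσ², Θ = max ‖θ_u‖, and let μ_i be the eigenvalues of X Xᵀ. When the confidence
intervals are valid, optimism and the oracle bound ρα F(S*) by the surrogate of the chosen set at
the upper indices. Passing back to p* costs at most 2c times the widths, and monotonicity gives f(S,
p*) ≤ F(S) (`round_regret_le`). A source chosen for the first time still has index 1, which its
width need not explain; but then the whole surrogate optimum is at most Θ ∑ ‖x_v‖, which that width
pays for because c ≥ √λ Θ.

Every play of a source adds the same matrix, so its estimator is diagonal in the eigenbasis of X Xᵀ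
and its widths depend only on the number of plays. The squared widths at play j sum to ∑ μ_i / (m +
j μ_i), which telescopes into logarithms (`sum_range_sum_widthSq_le`); Cauchy-Schwarz then gives the
rate (`sum_width_le`).

For validity, the feedback coordinates may be arbitrarily dependent, but Hoeffding's lemma for
linear combinations makes the noise subgaussian for the form X Xᵀ with factor n/4. A Gaussian
mixture of exponential supermartingales and Ville's inequality give a self-normalized bound uniform
in time (`measure_exists_lt_sum_sq_div_le`).

The factor n/4 leaves only (4/n) log(n²T) in the exponent of the failure probability, so the failure
cost can exceed 1/ρ. The excess is absorbed by a slack: since μ_i ≤ n, the potential argument yields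
the denominator log(1 + n/m), better than the claimed log(1 + 1/m). Where neither the trivial bound
nor 1/ρ suffices, n ≥ 2 and m > 1, the main term takes at most 7/8 of the claimed rate and the
failure cost at most 1/8 (`regret_rate_le`).

In the tabular case all μ_i equal 1 and this slack is gone, but each interval involves one scalar
noise, and a union bound over the n² pairs gives failure probability 1/(nT). -/

/-- Concavity of the logarithm between 1 and 1 + e₀: the ratio x / log(1 + x) is nondecreasing. -/
theorem mul_log_one_add_le {e e₀ : ℝ} (he : 0 ≤ e) (hle : e ≤ e₀) :
    e * Real.log (1 + e₀) ≤ e₀ * Real.log (1 + e) := by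
  rcases (he.trans hle).eq_or_lt with h0 | h0
  · have : e = 0 := le_antisymm (h0 ▸ hle) he
    simp [← h0, this]
  have ht : 0 ≤ 1 - e / e₀ := by rw [sub_nonneg, div_le_one h0]; exact hle
  have hc := (strictConcaveOn_log_Ioi.concaveOn).2 (show (1 : ℝ) ∈ Set.Ioi 0 by simp)
    (show 1 + e₀ ∈ Set.Ioi (0 : ℝ) by simp; linarith) ht (by positivity : 0 ≤ e / e₀) (by ring)
  have h1 : (1 - e / e₀) • (1 : ℝ) + (e / e₀) • (1 + e₀) = 1 + e := by
    simp only [smul_eq_mul]; field_simp; ring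
  rw [h1] at hc
  simp only [Real.log_one, mul_zero, zero_add, smul_eq_mul] at hc
  have := mul_le_mul_of_nonneg_left hc h0.le
  calc e * Real.log (1 + e₀) = e₀ * (e / e₀ * Real.log (1 + e₀)) := by field_simp
    _ ≤ _ := this

theorem log_one_add_le_nat_mul {d : ℕ} (hd : 0 < d) {y : ℝ} (hy : 0 ≤ y) :
    Real.log (1 + y) ≤ d * Real.log (1 + y / d) := by
  have hd' : (0 : ℝ) < d := by exact_mod_cast hd
  have h0 : 0 ≤ y / d := by positivity
  have h := one_add_mul_le_pow (a := y / d) (by linarith) d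
  rw [mul_div_cancel₀ _ hd'.ne'] at h
  rw [← Real.log_pow]
  exact Real.log_le_log (by linarith) h

theorem sum_log_one_add_le {d : ℕ} (hd : 0 < d) {y : Fin d → ℝ} (hy : ∀ i, 0 ≤ y i) :
    ∑ i, Real.log (1 + y i) ≤ d * Real.log (1 + (∑ i, y i) / d) := by
  have hd' : (0 : ℝ) < d := by exact_mod_cast hd
  have h := (strictConcaveOn_log_Ioi.concaveOn).le_map_sum (t := Finset.univ)
    (w := fun _ : Fin d => (1 : ℝ) / d) (p := fun i => 1 + y i)
    (fun _ _ => by positivity) (by simp [hd'.ne'])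
    (fun i _ => by simp; linarith [hy i])
  simp only [smul_eq_mul, ← Finset.mul_sum] at h
  have h1 : (1 : ℝ) / d * ∑ i, (1 + y i) = 1 + (∑ i, y i) / d := by
    simp [Finset.sum_add_distrib]; field_simp
  rw [h1] at h
  calc ∑ i, Real.log (1 + y i) = d * (1 / d * ∑ i, Real.log (1 + y i)) := by field_simp
    _ ≤ _ := by gcongr

/-- The logarithms telescope: passing from M to M + 1 multiplies 1 + Mμ/m by 1 + μ/(m + Mμ), and
`mul_log_one_add_le` compares each term with its logarithm. -/
theorem sum_range_div_mul_log_le {m μ e₀ : ℝ} (hm : 0 < m) (hμ : 0 ≤ μ) (hle : μ / m ≤ e₀)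
    (M : ℕ) :
    (∑ j ∈ Finset.range M, μ / (m + j * μ)) * Real.log (1 + e₀)
      ≤ e₀ * Real.log (1 + M * μ / m) := by
  induction M with
  | zero => simp
  | succ M ih =>
    have hp : 0 < m + M * μ := by positivity
    have hsmall : μ / (m + M * μ) ≤ e₀ := by
      refine le_trans ?_ hle
      gcongr
      nlinarith [mul_nonneg (Nat.cast_nonneg (α := ℝ) M) hμ]
    have h := mul_log_one_add_le (by positivity) hsmall
    have hs : Real.log (1 + (M + 1 : ℕ) * μ / m) =
        Real.log (1 + M * μ / m) + Real.log (1 + μ / (m + M * μ)) := by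
      rw [← Real.log_mul (by positivity) (by positivity)]
      congr 1
      push_cast
      field_simp
      ring
    rw [Finset.sum_range_succ, add_mul, hs, mul_add]
    exact add_le_add ih h

/-! ### Gaussian mixtures of exponential processes -/

open scoped ENNReal

theorem lintegral_pi_prod {ι : Type*} [Fintype ι] {ν : ι → Measure ℝ}
    [∀ i, IsProbabilityMeasure (ν i)] {f : ι → ℝ → ℝ≥0∞} (hf : ∀ i, Measurable (f i)) :
    ∫⁻ g, ∏ i, f i (g i) ∂(Measure.pi ν) = ∏ i, ∫⁻ x, f i x ∂(ν i) := by
  have hi : iIndepFun (fun (i : ι) (g : ι → ℝ) => f i (g i)) (Measure.pi ν) :=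
    iIndepFun_pi (X := fun i x => f i x) (fun i => (hf i).aemeasurable)
  have h := lintegral_prod_eq_prod_lintegral_of_indepFun Finset.univ
    (fun (i : ι) (g : ι → ℝ) => f i (g i)) hi (fun i => (hf i).comp (measurable_pi_apply i))
  rw [h]
  refine Finset.prod_congr rfl fun i _ => ?_
  rw [← (measurePreserving_eval ν i).lintegral_comp (hf i)]

/-- Variance of the Gaussian prior with precision `κ`. -/
noncomputable def priorVariance (κ : ℝ) : NNReal := (κ⁻¹).toNNReal

/-- Completing the square turns the integrand into a constant times the Gaussian density of mean
ξ/(κ + k) and precision κ + k. -/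
theorem lintegral_exp_gaussianReal {κ k : ℝ} (hκ : 0 < κ) (hk : 0 ≤ k) (ξ : ℝ) :
    ∫⁻ x, ENNReal.ofReal (Real.exp (x * ξ - k / 2 * x ^ 2)) ∂(gaussianReal 0 (priorVariance κ)) =
      ENNReal.ofReal (Real.sqrt (κ / (κ + k)) * Real.exp (ξ ^ 2 / (2 * (κ + k)))) := by
  have hκk : 0 < κ + k := by linarith
  have hv : priorVariance κ ≠ 0 := by simp [priorVariance, hκ]
  have hv' : priorVariance (κ + k) ≠ 0 := by simp [priorVariance, hκk]
  rw [gaussianReal_of_var_ne_zero _ hv,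
    lintegral_withDensity_eq_lintegral_mul _ (measurable_gaussianPDF _ _) (by fun_prop)]
  have key : ∀ x : ℝ, (gaussianPDF 0 (priorVariance κ) * fun x =>
      ENNReal.ofReal (Real.exp (x * ξ - k / 2 * x ^ 2))) x =
      ENNReal.ofReal (Real.sqrt (κ / (κ + k)) * Real.exp (ξ ^ 2 / (2 * (κ + k)))) *
        gaussianPDF (ξ / (κ + k)) (priorVariance (κ + k)) x := by
    intro x
    simp only [Pi.mul_apply, gaussianPDF]
    rw [← ENNReal.ofReal_mul (gaussianPDFReal_nonneg _ _ _), ← ENNReal.ofReal_mul (by positivity)]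
    congr 1
    simp only [gaussianPDFReal, priorVariance, Real.coe_toNNReal _ (inv_nonneg.2 hκ.le),
      Real.coe_toNNReal _ (inv_nonneg.2 hκk.le)]
    have h1 : (Real.sqrt (2 * Real.pi * κ⁻¹))⁻¹ =
        Real.sqrt (κ / (κ + k)) * (Real.sqrt (2 * Real.pi * (κ + k)⁻¹))⁻¹ := by
      rw [← Real.sqrt_inv, ← Real.sqrt_inv, ← Real.sqrt_mul (by positivity)]
      congr 1
      field_simp
    rw [h1, mul_assoc, ← Real.exp_add, mul_mul_mul_comm, ← Real.exp_add]
    congr 2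
    field_simp
    ring
  simp_rw [key]
  rw [lintegral_const_mul _ (measurable_gaussianPDF _ _), lintegral_gaussianPDF_eq_one _ hv',
    mul_one]

/-- The Gaussian mixture of the exponential processes
`exp (⟨g, ξ⟩ - R N / 2 * ∑ μ i * g i ^ 2)`, the prior being centered with precision `R * m`. -/
noncomputable def mixture {ι : Type*} [Fintype ι] (R m : ℝ) (μ : ι → ℝ) (N : ℕ) (ξ : ι → ℝ) :
    ℝ≥0∞ :=
  ∫⁻ g, ENNReal.ofReal (Real.exp (∑ i, (g i * ξ i - R * (N * μ i) / 2 * g i ^ 2)))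
    ∂(Measure.pi fun _ : ι => gaussianReal 0 (priorVariance (R * m)))

section Mixture

variable {ι : Type*} [Fintype ι] {R m : ℝ} {μ : ι → ℝ}

theorem mixture_zero : mixture R m μ 0 0 = 1 := by
  simp [mixture]

/-- Prior and exponent are both diagonal, so the integral factors. The prior precision carries R so
that R cancels from the determinant factor. -/
theorem mixture_eq (hR : 0 < R) (hm : 0 < m) (hμ : ∀ i, 0 ≤ μ i) (N : ℕ) (ξ : ι → ℝ) :
    mixture R m μ N ξ = ENNReal.ofReal (∏ i, (Real.sqrt (m / (m + N * μ i)) *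
      Real.exp (ξ i ^ 2 / (2 * (R * (m + N * μ i)))))) := by
  have hRm : 0 < R * m := by positivity
  unfold mixture
  simp_rw [Real.exp_sum]
  simp_rw [ENNReal.ofReal_prod_of_nonneg (fun i _ => (Real.exp_pos _).le)]
  rw [lintegral_pi_prod (f := fun i x => ENNReal.ofReal
    (Real.exp (x * ξ i - R * (N * μ i) / 2 * x ^ 2))) (fun i => by fun_prop)]
  rw [ENNReal.ofReal_prod_of_nonneg (fun i _ => by positivity)]
  refine Finset.prod_congr rfl fun i _ => ?_
  have hp : 0 ≤ (N : ℝ) * μ i := mul_nonneg (Nat.cast_nonneg _) (hμ i)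
  rw [lintegral_exp_gaussianReal hRm (by positivity), ← mul_add,
    mul_div_mul_left _ _ hR.ne']

/-- The self-normalized bound encoded by an upper bound on the mixture. -/
theorem sum_sq_div_le_of_mixture_lt (hR : 0 < R) (hm : 0 < m) (hμ : ∀ i, 0 ≤ μ i) {N : ℕ}
    {ξ : ι → ℝ} {q : ℝ} (h : mixture R m μ N ξ < ENNReal.ofReal (Real.exp q)) :
    ∑ i, ξ i ^ 2 / (m + N * μ i) ≤ R * (2 * q + ∑ i, Real.log (1 + N * μ i / m)) := by
  rw [mixture_eq hR hm hμ, ENNReal.ofReal_lt_ofReal_iff (Real.exp_pos _)] at h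
  have hp : ∀ i, 0 ≤ (N : ℝ) * μ i := fun i => mul_nonneg (Nat.cast_nonneg _) (hμ i)
  have hq : ∀ i, 0 < m + N * μ i := fun i => by have := hp i; positivity
  have hterm : ∀ i, Real.sqrt (m / (m + N * μ i)) * Real.exp (ξ i ^ 2 / (2 * (R * (m + N * μ i))))
      = Real.exp (-(1 / 2) * Real.log (1 + N * μ i / m) +
        1 / (2 * R) * (ξ i ^ 2 / (m + N * μ i))) := by
    intro i
    have := hq i
    have h1 : m / (m + N * μ i) = (1 + N * μ i / m)⁻¹ := by field_simp
    have h2 : 0 < 1 + N * μ i / m := by have := hp i; positivity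
    rw [Real.exp_add]
    congr 1
    · rw [h1, Real.sqrt_inv, Real.sqrt_eq_rpow, ← Real.rpow_neg h2.le,
        Real.rpow_def_of_pos h2, mul_comm]
    · congr 1
      field_simp
  simp_rw [hterm, ← Real.exp_sum, Finset.sum_add_distrib, ← Finset.mul_sum] at h
  have h' := Real.exp_lt_exp.1 h
  have h3 := mul_le_mul_of_nonneg_left h'.le (by positivity : 0 ≤ 2 * R)
  have h4 : 2 * R * (-(1 / 2) * ∑ i, Real.log (1 + N * μ i / m) +
      1 / (2 * R) * ∑ i, ξ i ^ 2 / (m + N * μ i)) =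
      -R * ∑ i, Real.log (1 + N * μ i / m) + ∑ i, ξ i ^ 2 / (m + N * μ i) := by
    field_simp
  rw [h4] at h3
  linarith

/-- The mixture is a supermartingale for increments that are subgaussian with respect to the
quadratic form of `μ`. -/
theorem lintegral_mixture_le {W : Type*} [MeasurableSpace W] {P : Measure W} [SFinite P]
    {η : W → ι → ℝ} (hη : Measurable η)
    (hsub : ∀ g : ι → ℝ, ∫⁻ z, ENNReal.ofReal (Real.exp (∑ i, g i * η z i)) ∂P ≤
      ENNReal.ofReal (Real.exp (R / 2 * ∑ i, μ i * g i ^ 2)))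
    (N : ℕ) (ξ : ι → ℝ) :
    ∫⁻ z, mixture R m μ (N + 1) (ξ + η z) ∂P ≤ mixture R m μ N ξ := by
  unfold mixture
  rw [lintegral_lintegral_swap (by
    refine Measurable.aemeasurable ?_
    simp only [Function.uncurry_def, Pi.add_apply]
    fun_prop)]
  refine lintegral_mono fun g => ?_
  -- For fixed g the new round contributes one exponential increment and the compensator that `hsub`
  -- is able to cancel.
  have hsplit : ∀ z, ENNReal.ofReal (Real.exp (∑ i, (g i * (ξ + η z) i -
      R * ((N + 1 : ℕ) * μ i) / 2 * g i ^ 2))) =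
      ENNReal.ofReal (Real.exp (∑ i, (g i * ξ i - R * (N * μ i) / 2 * g i ^ 2)
        - R / 2 * ∑ i, μ i * g i ^ 2)) *
      ENNReal.ofReal (Real.exp (∑ i, g i * η z i)) := by
    intro z
    rw [← ENNReal.ofReal_mul (Real.exp_pos _).le, ← Real.exp_add, Finset.mul_sum,
      ← Finset.sum_sub_distrib, ← Finset.sum_add_distrib]
    congr 3
    funext i
    push_cast
    simp only [Pi.add_apply]
    ring
  simp_rw [hsplit]
  rw [lintegral_const_mul _ (by fun_prop)]
  refine (mul_le_mul_right (hsub g) _).trans ?_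
  rw [← ENNReal.ofReal_mul (Real.exp_pos _).le, ← Real.exp_add, sub_add_cancel]

end Mixture

end IMBandit

namespace IMBandit

open Matrix

/-! ### Coordinates in the eigenbasis of X Xᵀ -/

section Spectral

variable {n d : ℕ} (X : Matrix (Fin d) (Fin n) ℝ)

theorem isHermitian_mul_transpose : (X * X.transpose).IsHermitian := by
  simpa using Matrix.isHermitian_mul_conjTranspose_self X

theorem posSemidef_mul_transpose : (X * X.transpose).PosSemidef := by
  simpa using Matrix.posSemidef_self_mul_conjTranspose X

/-- The eigenvalues of `X Xᵀ`. -/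
noncomputable def eigval (i : Fin d) : ℝ := (isHermitian_mul_transpose X).eigenvalues i

/-- An orthonormal basis of eigenvectors of `X Xᵀ`. -/
noncomputable def eigvec (i : Fin d) : EuclideanSpace ℝ (Fin d) :=
  (isHermitian_mul_transpose X).eigenvectorBasis i

/-- The coordinates of a vector in the basis of eigenvectors of `X Xᵀ`. -/
noncomputable def coord (y : Fin d → ℝ) (i : Fin d) : ℝ := (eigvec X i).ofLp ⬝ᵥ y

theorem eigval_nonneg (i : Fin d) : 0 ≤ eigval X i :=
  (posSemidef_mul_transpose X).eigenvalues_nonneg i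

theorem coord_eq_inner (y : Fin d → ℝ) (i : Fin d) :
    coord X y i = inner ℝ (eigvec X i) (WithLp.toLp 2 y) := by
  simp [coord, EuclideanSpace.inner_eq_star_dotProduct, dotProduct_comm]

theorem mulVec_eigvec (i : Fin d) :
    (X * X.transpose) *ᵥ (eigvec X i).ofLp = eigval X i • (eigvec X i).ofLp :=
  (isHermitian_mul_transpose X).mulVec_eigenvectorBasis i

theorem dotProduct_eq_sum_coord (y z : Fin d → ℝ) :
    y ⬝ᵥ z = ∑ i, coord X y i * coord X z i := by
  have h := (isHermitian_mul_transpose X).eigenvectorBasis.sum_inner_mul_inner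
    (WithLp.toLp 2 y) (WithLp.toLp 2 z)
  simp only [EuclideanSpace.inner_eq_star_dotProduct, star_trivial] at h
  rw [dotProduct_comm, ← h]
  refine Finset.sum_congr rfl fun i _ => ?_
  rw [coord, coord, dotProduct_comm z]
  rfl

theorem coord_mulVec (a : Fin n → ℝ) (i : Fin d) :
    coord X (X *ᵥ a) i = ∑ v, a v * coord X (fun k => X k v) i := by
  rw [coord, dotProduct_mulVec]
  simp only [dotProduct, vecMul, coord]
  refine Finset.sum_congr rfl fun v _ => ?_
  ring

theorem coord_add (y z : Fin d → ℝ) (i : Fin d) :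
    coord X (y + z) i = coord X y i + coord X z i := by
  simp [coord, dotProduct_add]

theorem coord_smul (a : ℝ) (y : Fin d → ℝ) (i : Fin d) :
    coord X (a • y) i = a * coord X y i := by
  simp [coord]

theorem coord_mul_transpose_mulVec (y : Fin d → ℝ) (i : Fin d) :
    coord X ((X * X.transpose) *ᵥ y) i = eigval X i * coord X y i := by
  have hs : (X * X.transpose).transpose = X * X.transpose := by simp
  rw [coord, dotProduct_mulVec, ← mulVec_transpose, hs, mulVec_eigvec]
  simp [coord]

/-- For the unit eigenvector e, both sides are ‖Xᵀe‖² = ⟨e, X Xᵀ e⟩. -/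
theorem sum_coord_feature_sq (i : Fin d) :
    ∑ v, coord X (fun k => X k v) i ^ 2 = eigval X i := by
  have h1 : (eigvec X i).ofLp ⬝ᵥ (eigvec X i).ofLp = 1 := by
    have := (isHermitian_mul_transpose X).eigenvectorBasis.orthonormal.1 i
    have h2 : inner ℝ (eigvec X i) (eigvec X i) = (1 : ℝ) := by
      rw [real_inner_self_eq_norm_sq]
      simp [eigvec]
    rw [EuclideanSpace.inner_eq_star_dotProduct] at h2
    simpa only [star_trivial] using h2
  have h : (eigvec X i).ofLp ⬝ᵥ ((X * X.transpose) *ᵥ (eigvec X i).ofLp) = eigval X i := by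
    rw [mulVec_eigvec, dotProduct_smul, h1, smul_eq_mul, mul_one]
  rw [← h, ← mulVec_mulVec, dotProduct_mulVec, mulVec_transpose]
  simp only [dotProduct, vecMul, coord, sq]

theorem sum_eigval : ∑ i, eigval X i = ∑ v, ‖feature X v‖ ^ 2 := by
  simp_rw [← sum_coord_feature_sq]
  rw [Finset.sum_comm]
  refine Finset.sum_congr rfl fun v _ => ?_
  have h := dotProduct_eq_sum_coord X (fun k => X k v) (fun k => X k v)
  simp_rw [sq, ← h]
  simp [feature, ← sq, EuclideanSpace.norm_sq_eq, dotProduct]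

theorem sum_eigval_le (hX : ∀ v, ‖feature X v‖ ≤ 1) : ∑ i, eigval X i ≤ n := by
  rw [sum_eigval]
  calc ∑ v, ‖feature X v‖ ^ 2 ≤ ∑ _v : Fin n, (1 : ℝ) :=
        Finset.sum_le_sum fun v _ => pow_le_one₀ (norm_nonneg _) (hX v)
    _ = n := by simp

theorem eigval_le (hX : ∀ v, ‖feature X v‖ ≤ 1) (i : Fin d) : eigval X i ≤ n :=
  (Finset.single_le_sum (fun j _ => eigval_nonneg X j) (Finset.mem_univ i)).trans
    (sum_eigval_le X hX)

theorem sum_coord_sq (θ : EuclideanSpace ℝ (Fin d)) :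
    ∑ i, coord X θ.ofLp i ^ 2 = ‖θ‖ ^ 2 := by
  have h := dotProduct_eq_sum_coord X θ.ofLp θ.ofLp
  simp_rw [sq, ← h]
  simp [← sq, EuclideanSpace.norm_sq_eq, dotProduct]

/-- The matrix is positive definite, hence invertible; taking coordinates in G (G⁻¹ y) = y gives the
quotient. -/
theorem coord_inv_mulVec {lam s : ℝ} (hlam : 0 < lam) (hs : 0 ≤ s) (y : Fin d → ℝ) (i : Fin d) :
    coord X ((lam • (1 : Matrix (Fin d) (Fin d) ℝ) + s • (X * X.transpose))⁻¹ *ᵥ y) i =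
      coord X y i / (lam + s * eigval X i) := by
  set G := lam • (1 : Matrix (Fin d) (Fin d) ℝ) + s • (X * X.transpose) with hG
  have hpos : G.PosDef :=
    (Matrix.PosDef.one.smul hlam).add_posSemidef ((posSemidef_mul_transpose X).smul hs)
  have hdet : IsUnit G.det := hpos.det_pos.ne'.isUnit
  have hy : G *ᵥ (G⁻¹ *ᵥ y) = y := by
    rw [mulVec_mulVec, Matrix.mul_nonsing_inv _ hdet, one_mulVec]
  have hγ : 0 < lam + s * eigval X i := by
    have := mul_nonneg hs (eigval_nonneg X i); linarith
  rw [eq_div_iff hγ.ne']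
  conv_rhs => rw [← hy]
  rw [hG, add_mulVec, smul_mulVec, smul_mulVec, one_mulVec, coord_add, coord_smul, coord_smul,
    coord_mul_transpose_mulVec, ← hG]
  ring

end Spectral

/-! ### Confidence widths, elliptical potential and estimation error -/

section Width

variable {n d : ℕ} (X : Matrix (Fin d) (Fin n) ℝ) (m : ℝ)

/-- The squared norm of the feature `x_v` for the inverse of `m I + N X Xᵀ`. -/
noncomputable def widthSq (N : ℕ) (v : Fin n) : ℝ :=
  ∑ i, coord X (fun k => X k v) i ^ 2 / (m + N * eigval X i)

variable {m}

theorem add_mul_eigval_pos (hm : 0 < m) (N : ℕ) (i : Fin d) : 0 < m + N * eigval X i := by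
  have := mul_nonneg (Nat.cast_nonneg (α := ℝ) N) (eigval_nonneg X i)
  linarith

theorem widthSq_nonneg (hm : 0 < m) (N : ℕ) (v : Fin n) : 0 ≤ widthSq X m N v :=
  Finset.sum_nonneg fun i _ => div_nonneg (sq_nonneg _) (add_mul_eigval_pos X hm N i).le

theorem widthSq_zero (v : Fin n) : widthSq X m 0 v = ‖feature X v‖ ^ 2 / m := by
  have := sum_coord_sq X (feature X v)
  simp only [widthSq, Nat.cast_zero, zero_mul, add_zero, ← Finset.sum_div]
  rw [← this]
  rfl

theorem sum_widthSq (N : ℕ) :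
    ∑ v, widthSq X m N v = ∑ i, eigval X i / (m + N * eigval X i) := by
  unfold widthSq
  rw [Finset.sum_comm]
  refine Finset.sum_congr rfl fun i _ => ?_
  rw [← Finset.sum_div, sum_coord_feature_sq]

/-- The elliptical potential bound for repeated rank-`n` updates. -/
theorem sum_range_sum_widthSq_le (hm : 0 < m) {e₀ : ℝ} (he : ∀ i, eigval X i / m ≤ e₀)
    (M : ℕ) :
    (∑ j ∈ Finset.range M, ∑ v, widthSq X m j v) * Real.log (1 + e₀) ≤
      e₀ * ∑ i, Real.log (1 + M * eigval X i / m) := by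
  simp_rw [sum_widthSq]
  rw [Finset.sum_comm, Finset.sum_mul, Finset.mul_sum]
  exact Finset.sum_le_sum fun i _ =>
    sum_range_div_mul_log_le hm (eigval_nonneg X i) (he i) M

/-- Jensen's inequality replaces the eigenvalues by their mean, and the trace of X Xᵀ is at most n.
-/
theorem sum_log_eigval_le (hd : 0 < d) (hm : 0 < m) (hX : ∀ v, ‖feature X v‖ ≤ 1) {M T : ℕ}
    (hM : M ≤ T) :
    ∑ i, Real.log (1 + M * eigval X i / m) ≤ d * Real.log (1 + n * T / (d * m)) := by
  have h0 : ∀ i, 0 ≤ M * eigval X i / m := fun i =>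
    div_nonneg (mul_nonneg (Nat.cast_nonneg _) (eigval_nonneg X i)) hm.le
  refine (sum_log_one_add_le hd h0).trans ?_
  have hs : 0 ≤ ∑ i, M * eigval X i / m := Finset.sum_nonneg fun i _ => h0 i
  have hle : ∑ i, M * eigval X i / m ≤ n * T / m := by
    rw [← Finset.sum_div, ← Finset.mul_sum, mul_comm (n : ℝ)]
    have := sum_eigval_le X hX
    have h2 : (M : ℝ) ≤ T := by exact_mod_cast hM
    have h3 : 0 ≤ ∑ i, eigval X i := Finset.sum_nonneg fun i _ => eigval_nonneg X i
    gcongr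
  have hd' : (0 : ℝ) < d := by exact_mod_cast hd
  have h4 : (n : ℝ) * T / (d * m) = n * T / m / d := by field_simp
  rw [h4]
  gcongr

/-- Linear generalization says p = Xᵀθ, so X p = X Xᵀ θ. -/
theorem coord_mulVec_linear {θ : EuclideanSpace ℝ (Fin d)} {p : Fin n → ℝ}
    (hp : ∀ v, p v = inner ℝ θ (feature X v)) (i : Fin d) :
    coord X (X *ᵥ p) i = eigval X i * coord X θ.ofLp i := by
  rw [← coord_mul_transpose_mulVec, ← mulVec_mulVec]
  congr 2
  funext v
  rw [hp, EuclideanSpace.inner_eq_star_dotProduct]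
  simp [feature, mulVec, dotProduct]

theorem inner_eq_sum_coord (θ : EuclideanSpace ℝ (Fin d)) (v : Fin n) :
    inner ℝ θ (feature X v) = ∑ i, coord X θ.ofLp i * coord X (fun k => X k v) i := by
  rw [← dotProduct_eq_sum_coord, EuclideanSpace.inner_eq_star_dotProduct]
  simp [feature, dotProduct_comm]

/-- The Gram matrix is σ⁻² (m I + N X Xᵀ) with m = λσ², which brings out the factor σ. -/
theorem sqrt_dotProduct_inv_mulVec {lam σ : ℝ} (hlam : 0 < lam) (hσ : 0 < σ) (N : ℕ)
    (v : Fin n) :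
    Real.sqrt ((fun k => X k v) ⬝ᵥ ((lam • (1 : Matrix (Fin d) (Fin d) ℝ) +
      (N * (σ ^ 2)⁻¹) • (X * X.transpose))⁻¹ *ᵥ (fun k => X k v))) =
      σ * Real.sqrt (widthSq X (lam * σ ^ 2) N v) := by
  rw [dotProduct_eq_sum_coord X, ← Real.sqrt_sq hσ.le, ← Real.sqrt_mul (sq_nonneg _),
    Real.sqrt_sq hσ.le, widthSq, Finset.mul_sum]
  congr 1
  refine Finset.sum_congr rfl fun i _ => ?_
  rw [coord_inv_mulVec X hlam (by positivity)]
  have h1 : lam + N * (σ ^ 2)⁻¹ * eigval X i ≠ 0 := by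
    have := eigval_nonneg X i; positivity
  have h2 := (add_mul_eigval_pos X (by positivity : 0 < lam * σ ^ 2) N i).ne'
  field_simp

/-- The estimation error in the direction of `x_v` after `N` plays with centered feedback `s`. -/
theorem estimate_sub_eq {lam σ : ℝ} (hlam : 0 < lam) (hσ : 0 < σ) {θ : EuclideanSpace ℝ (Fin d)}
    {p : Fin n → ℝ} (hp : ∀ v, p v = inner ℝ θ (feature X v)) (N : ℕ) (s : Fin n → ℝ)
    (v : Fin n) :
    ((σ ^ 2)⁻¹ • ((lam • (1 : Matrix (Fin d) (Fin d) ℝ) +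
      (N * (σ ^ 2)⁻¹) • (X * X.transpose))⁻¹ *ᵥ (X *ᵥ (s + (N : ℝ) • p)))) ⬝ᵥ (fun k => X k v)
      - p v = ∑ i, coord X (fun k => X k v) i *
        ((coord X (X *ᵥ s) i - lam * σ ^ 2 * coord X θ.ofLp i) /
          (lam * σ ^ 2 + N * eigval X i)) := by
  rw [hp, inner_eq_sum_coord, dotProduct_eq_sum_coord X, ← Finset.sum_sub_distrib]
  refine Finset.sum_congr rfl fun i _ => ?_
  rw [coord_smul, coord_inv_mulVec X hlam (by positivity), mulVec_add, coord_add, mulVec_smul,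
    coord_smul, coord_mulVec_linear X hp]
  have h1 : lam + N * (σ ^ 2)⁻¹ * eigval X i ≠ 0 := by
    have := eigval_nonneg X i; positivity
  have h2 := (add_mul_eigval_pos X (by positivity : 0 < lam * σ ^ 2) N i).ne'
  have h3 : lam + N * (σ ^ 2)⁻¹ * eigval X i =
      (lam * σ ^ 2 + N * eigval X i) / σ ^ 2 := by field_simp
  -- Writing N times the eigenvalue as D - λσ² cancels the true weight and leaves the ridge bias
  -- -λσ² θ.
  obtain ⟨D, hD⟩ : ∃ D, D = lam * σ ^ 2 + N * eigval X i := ⟨_, rfl⟩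
  have h4 : N * (eigval X i * coord X θ.ofLp i) = (D - lam * σ ^ 2) * coord X θ.ofLp i := by
    rw [hD]; ring
  rw [h3, ← hD, h4]
  rw [← hD] at h2
  field_simp
  ring

/-- Self-normalized control of the estimation error. -/
theorem abs_sum_coord_le (hm : 0 < m) {ξ θ' : Fin d → ℝ} {A Θ : ℝ} (hA : 0 ≤ A) (hΘ : 0 ≤ Θ)
    {N : ℕ} (hξ : ∑ i, ξ i ^ 2 / (m + N * eigval X i) ≤ A ^ 2)
    (hθ : ∑ i, θ' i ^ 2 ≤ Θ ^ 2) (v : Fin n) :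
    |∑ i, coord X (fun k => X k v) i * ((ξ i - m * θ' i) / (m + N * eigval X i))| ≤
      (A + Real.sqrt m * Θ) * Real.sqrt (widthSq X m N v) := by
  have hpos := add_mul_eigval_pos X hm N
  -- Weighted Cauchy-Schwarz, used once for the noise and once for the ridge bias; for the latter m²
  -- / (m + N μ_i) ≤ m.
  have cs : ∀ (f : Fin d → ℝ) (B : ℝ), 0 ≤ B → ∑ i, f i ^ 2 / (m + N * eigval X i) ≤ B ^ 2 →
      |∑ i, coord X (fun k => X k v) i * (f i / (m + N * eigval X i))| ≤
        B * Real.sqrt (widthSq X m N v) := by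
    intro f B hB hf
    have h := Finset.sum_mul_sq_le_sq_mul_sq Finset.univ
      (fun i => coord X (fun k => X k v) i / Real.sqrt (m + N * eigval X i))
      (fun i => f i / Real.sqrt (m + N * eigval X i))
    have e1 : ∀ i, coord X (fun k => X k v) i / Real.sqrt (m + N * eigval X i) *
        (f i / Real.sqrt (m + N * eigval X i)) =
        coord X (fun k => X k v) i * (f i / (m + N * eigval X i)) := by
      intro i
      rw [div_mul_div_comm, Real.mul_self_sqrt (hpos i).le, mul_div_assoc]
    simp_rw [e1, div_pow, Real.sq_sqrt (hpos _).le] at h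
    rw [← Real.sqrt_sq hB, ← Real.sqrt_mul (sq_nonneg _)]
    refine Real.abs_le_sqrt (h.trans ?_)
    rw [mul_comm]
    exact mul_le_mul_of_nonneg_right hf (widthSq_nonneg X hm N v)
  have h1 := cs ξ A hA hξ
  have h2 := cs (fun i => m * θ' i) (Real.sqrt m * Θ) (by positivity) (by
    rw [mul_pow, Real.sq_sqrt hm.le]
    refine le_trans ?_ (mul_le_mul_of_nonneg_left hθ hm.le)
    rw [Finset.mul_sum]
    refine Finset.sum_le_sum fun i _ => ?_
    rw [div_le_iff₀ (hpos i)]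
    have := mul_nonneg (mul_nonneg hm.le (sq_nonneg (θ' i)))
      (mul_nonneg (Nat.cast_nonneg (α := ℝ) N) (eigval_nonneg X i))
    nlinarith)
  simp_rw [sub_div, mul_sub, Finset.sum_sub_distrib]
  rw [add_mul]
  exact (abs_sub _ _).trans (add_le_add h1 h2)

end Width

end IMBandit

namespace IMBandit

open scoped ENNReal

/-! ### Subgaussian feedback -/

section Subgaussian

variable {n : ℕ} {W : Type*} [MeasurableSpace W] (D : DiffusionModel n W)

theorem measurable_reach (S : Finset (Fin n)) (v : Fin n) : Measurable (D.reach S v) :=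
  Measurable.ite (D.measurableSet_influenced S v) measurable_const measurable_const

theorem reach_mem_Icc (S : Finset (Fin n)) (v : Fin n) (z : W) :
    D.reach S v z ∈ Set.Icc (0 : ℝ) 1 := by
  unfold DiffusionModel.reach
  split_ifs <;> simp

theorem integrable_reach (S : Finset (Fin n)) (v : Fin n) : Integrable (D.reach S v) D.law := by
  have := D.isProbabilityMeasure
  exact Integrable.of_mem_Icc 0 1 (measurable_reach D S v).aemeasurable
    (Filter.Eventually.of_forall (reach_mem_Icc D S v))

theorem influenceProb_mem_Icc (S : Finset (Fin n)) (v : Fin n) :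
    D.influenceProb S v ∈ Set.Icc (0 : ℝ) 1 := by
  have := D.isProbabilityMeasure
  refine ⟨integral_nonneg fun z => (reach_mem_Icc D S v z).1, ?_⟩
  calc ∫ z, D.reach S v z ∂D.law ≤ ∫ _z, (1 : ℝ) ∂D.law :=
        integral_mono (integrable_reach D S v) (integrable_const _)
          fun z => (reach_mem_Icc D S v z).2
    _ = 1 := by simp

/-- Hoeffding's lemma for an arbitrarily correlated vector of centered indicators. -/
theorem lintegral_exp_feedback_le (u : Fin n) (a : Fin n → ℝ) :
    ∫⁻ z, ENNReal.ofReal (Real.exp (∑ v, a v * (D.reach {u} v z - D.pairwiseReach u v))) ∂D.law ≤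
      ENNReal.ofReal (Real.exp ((∑ v, |a v|) ^ 2 / 8)) := by
  have := D.isProbabilityMeasure
  set Z : W → ℝ := fun z => ∑ v, a v * D.reach {u} v z with hZ
  have hZm : Measurable Z :=
    Finset.measurable_sum _ fun v _ => (measurable_reach D {u} v).const_mul _
  -- Each term lies between minus the negative part and the positive part of its coefficient, so the
  -- range has length ∑ |a v| whatever the dependence.
  have hb : ∀ z, Z z ∈ Set.Icc (∑ v, (a v - |a v|) / 2) (∑ v, (a v + |a v|) / 2) := by
    intro z
    have hv : ∀ v, (a v - |a v|) / 2 ≤ a v * D.reach {u} v z ∧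
        a v * D.reach {u} v z ≤ (a v + |a v|) / 2 := by
      intro v
      unfold DiffusionModel.reach
      split_ifs
      · constructor <;> linarith [le_abs_self (a v), neg_abs_le (a v)]
      · constructor <;> linarith [le_abs_self (a v), neg_abs_le (a v)]
    exact ⟨Finset.sum_le_sum fun v _ => (hv v).1, Finset.sum_le_sum fun v _ => (hv v).2⟩
  have hsg := hasSubgaussianMGF_of_mem_Icc hZm.aemeasurable (μ := D.law)
    (Filter.Eventually.of_forall hb)
  have hint : ∫ z, Z z ∂D.law = ∑ v, a v * D.pairwiseReach u v := by
    rw [integral_finsetSum _ fun v _ => (integrable_reach D {u} v).const_mul _]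
    refine Finset.sum_congr rfl fun v _ => ?_
    rw [integral_const_mul]
    rfl
  have hsub : ∀ z, ∑ v, a v * (D.reach {u} v z - D.pairwiseReach u v) =
      1 * (Z z - ∫ z, Z z ∂D.law) := by
    intro z
    rw [hint, one_mul, hZ, ← Finset.sum_sub_distrib]
    exact Finset.sum_congr rfl fun v _ => mul_sub _ _ _
  simp_rw [hsub]
  rw [← ofReal_integral_eq_lintegral_ofReal (hsg.integrable_exp_mul 1)
    (Filter.Eventually.of_forall fun _ => (Real.exp_pos _).le)]
  refine ENNReal.ofReal_le_ofReal ((hsg.mgf_le 1).trans (Real.exp_le_exp.2 ?_))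
  have hlen : ∑ v, (a v + |a v|) / 2 - ∑ v, (a v - |a v|) / 2 = ∑ v, |a v| := by
    rw [← Finset.sum_sub_distrib]
    exact Finset.sum_congr rfl fun v _ => by ring
  push_cast
  rw [hlen, Real.norm_eq_abs, one_pow, mul_one, div_pow, sq_abs]
  linarith

/-- With G the vector of coordinates g, both sides are ‖XᵀG‖² = ⟨G, X Xᵀ G⟩. -/
theorem sum_sum_mul_coord_sq {d : ℕ} (X : Matrix (Fin d) (Fin n) ℝ) (g : Fin d → ℝ) :
    ∑ v, (∑ i, g i * coord X (fun k => X k v) i) ^ 2 = ∑ i, eigval X i * g i ^ 2 := by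
  set G : EuclideanSpace ℝ (Fin d) :=
    (isHermitian_mul_transpose X).eigenvectorBasis.repr.symm (WithLp.toLp 2 g) with hG
  have hg : ∀ i, coord X G.ofLp i = g i := by
    intro i
    rw [coord_eq_inner, eigvec]
    rw [← OrthonormalBasis.repr_apply_apply]
    simp [hG]
  have h1 : ∀ v, ∑ i, g i * coord X (fun k => X k v) i = (X.transpose.mulVec G.ofLp) v := by
    intro v
    simp_rw [← hg]
    rw [← dotProduct_eq_sum_coord, dotProduct_comm]
    rfl
  have h2 := dotProduct_eq_sum_coord X G.ofLp ((X * X.transpose).mulVec G.ofLp)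
  simp_rw [coord_mul_transpose_mulVec, hg] at h2
  simp_rw [h1]
  calc ∑ v, (X.transpose.mulVec G.ofLp) v ^ 2
      = dotProduct (X.transpose.mulVec G.ofLp) (X.transpose.mulVec G.ofLp) := by
        simp [dotProduct, sq]
    _ = dotProduct G.ofLp ((X * X.transpose).mulVec G.ofLp) := by
        rw [← Matrix.mulVec_mulVec, Matrix.dotProduct_mulVec G.ofLp, Matrix.mulVec_transpose]
    _ = ∑ i, eigval X i * g i ^ 2 := by
        rw [h2]
        exact Finset.sum_congr rfl fun i _ => by ring

/-- The centered pairwise feedback of the source `u`. -/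
noncomputable def noise (u : Fin n) (z : W) (v : Fin n) : ℝ :=
  D.reach {u} v z - D.pairwiseReach u v

theorem measurable_noise (u v : Fin n) : Measurable fun z => noise D u z v :=
  (measurable_reach D {u} v).sub_const _

/-- Cauchy-Schwarz replaces (∑ |a_v|)² by n ∑ a_v²; the factor n is the price of arbitrary
correlation between target nodes. -/
theorem lintegral_exp_coord_noise_le {d : ℕ} (X : Matrix (Fin d) (Fin n) ℝ) (u : Fin n)
    (g : Fin d → ℝ) :
    ∫⁻ z, ENNReal.ofReal (Real.exp (∑ i, g i * coord X (X.mulVec (noise D u z)) i)) ∂D.law ≤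
      ENNReal.ofReal (Real.exp ((n : ℝ) / 4 / 2 * ∑ i, eigval X i * g i ^ 2)) := by
  have h1 : ∀ z, ∑ i, g i * coord X (X.mulVec (noise D u z)) i =
      ∑ v, (∑ i, g i * coord X (fun k => X k v) i) *
        (D.reach {u} v z - D.pairwiseReach u v) := by
    intro z
    simp_rw [coord_mulVec, Finset.mul_sum, Finset.sum_mul]
    rw [Finset.sum_comm]
    refine Finset.sum_congr rfl fun v _ => Finset.sum_congr rfl fun i _ => ?_
    rw [noise]
    ring
  simp_rw [h1]
  refine (lintegral_exp_feedback_le D u _).trans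
    (ENNReal.ofReal_le_ofReal (Real.exp_le_exp.2 ?_))
  rw [← sum_sum_mul_coord_sq]
  have h2 := sq_sum_le_card_mul_sum_sq (s := Finset.univ)
    (f := fun v : Fin n => |∑ i, g i * coord X (fun k => X k v) i|)
  simp only [sq_abs, Finset.card_univ, Fintype.card_fin] at h2
  linarith

/-- A single target node has variance proxy 1/4, without the factor n; this serves the tabular case.
-/
theorem lintegral_exp_noise_le (u v : Fin n) (g : Unit → ℝ) :
    ∫⁻ z, ENNReal.ofReal (Real.exp (∑ i, g i * noise D u z v)) ∂D.law ≤
      ENNReal.ofReal (Real.exp ((1 : ℝ) / 4 / 2 * ∑ i, 1 * g i ^ 2)) := by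
  refine le_trans (le_of_eq ?_) ((lintegral_exp_feedback_le D u (Pi.single v (g ()))).trans
    (ENNReal.ofReal_le_ofReal (Real.exp_le_exp.2 (le_of_eq ?_))))
  · refine lintegral_congr fun z => ?_
    congr 2
    rw [Finset.sum_eq_single v]
    · simp [noise]
    · intro b _ hb
      simp [hb]
    · simp
  · have : ∑ b, |(Pi.single v (g ()) : Fin n → ℝ) b| = |g ()| := by
      rw [Finset.sum_eq_single v]
      · simp
      · intro b _ hb
        simp [hb]
      · simp
    rw [this, sq_abs]
    simp
    ring

end Subgaussian

/-! ### Dependence on the finite history of feedback -/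

section History

variable {n : ℕ} {W Ω : Type*} [MeasurableSpace W] (D : DiffusionModel n W)

/-- The pairwise influences of a realization of the diffusion. -/
def pattern (z : W) (u v : Fin n) : Bool := decide (v ∈ D.influenced {u} z)

theorem measurable_pattern : Measurable (pattern D) := by
  refine measurable_pi_lambda _ fun u => measurable_pi_lambda _ fun v => ?_
  refine measurable_to_bool ?_
  have : (fun z => pattern D z u v) ⁻¹' {true} = {z | v ∈ D.influenced {u} z} := by
    ext z
    simp [pattern]
  rw [this]
  exact D.measurableSet_influenced {u} v

theorem reach_congr {z z' : W} (h : pattern D z = pattern D z') (u v : Fin n) :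
    D.reach {u} v z = D.reach {u} v z' := by
  have := congr_fun (congr_fun h u) v
  simp only [pattern, decide_eq_decide] at this
  simp only [DiffusionModel.reach, this]

/-- `f` depends on the realizations of the first `t` rounds only through their patterns. -/
def DependsOnPast {β : Type*} (w : ℕ → Ω → W) (t : ℕ) (f : Ω → β) : Prop :=
  ∀ ω ω', (∀ i < t, pattern D (w i ω) = pattern D (w i ω')) → f ω = f ω'

variable {D} {w : ℕ → Ω → W} {β : Type*} {f : Ω → β} {t : ℕ}

theorem DependsOnPast.mono {s : ℕ} (hf : DependsOnPast D w s f) (hst : s ≤ t) :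
    DependsOnPast D w t f :=
  fun ω ω' h => hf ω ω' fun i hi => h i (hi.trans_le hst)

theorem DependsOnPast.exists_eq [Nonempty Ω] (hf : DependsOnPast D w t f) :
    ∃ g : (Finset.range t → Fin n → Fin n → Bool) → β,
      f = fun ω => g fun i => pattern D (w i ω) := by
  have : Nonempty β := (inferInstance : Nonempty Ω).map f
  have h : f.FactorsThrough fun ω (i : Finset.range t) => pattern D (w i ω) := by
    intro ω ω' h
    exact hf ω ω' fun i hi => congr_fun h ⟨i, Finset.mem_range.2 hi⟩
  exact (Function.factorsThrough_iff f).1 h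

variable [MeasurableSpace Ω]

theorem measurable_history (hw : ∀ t, Measurable (w t)) (t : ℕ) :
    Measurable fun ω (i : Finset.range t) => pattern D (w i ω) :=
  measurable_pi_lambda _ fun i => (measurable_pattern D).comp (hw i)

/-- The history takes finitely many values, so no measurability of the oracle is needed. -/
theorem DependsOnPast.measurable [Nonempty Ω] [MeasurableSpace β] (hw : ∀ t, Measurable (w t))
    (hf : DependsOnPast D w t f) : Measurable f := by
  obtain ⟨g, rfl⟩ := hf.exists_eq
  exact (measurable_of_countable g).comp (measurable_history hw t)

/-- The realization of round `t` can be averaged out before the past. -/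
theorem DependsOnPast.lintegral_eq {μ : Measure Ω} [IsProbabilityMeasure μ]
    (hw : ∀ t, Measurable (w t)) (hlaw : ∀ t, μ.map (w t) = D.law) (hind : iIndepFun w μ)
    (hf : DependsOnPast D w t f) {φ : β → W → ℝ≥0∞} (hφ : ∀ b, Measurable (φ b)) :
    ∫⁻ ω, φ (f ω) (w t ω) ∂μ = ∫⁻ ω, ∫⁻ z, φ (f ω) z ∂D.law ∂μ := by
  have : Nonempty Ω := nonempty_of_isProbabilityMeasure μ
  have := D.isProbabilityMeasure
  obtain ⟨g, rfl⟩ := hf.exists_eq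
  set H : Ω → Finset.range t → Fin n → Fin n → Bool := fun ω i => pattern D (w i ω) with hH
  have hHm : Measurable H := measurable_history hw t
  have hindep : IndepFun H (w t) μ := by
    have h0 := hind.indepFun_finset (Finset.range t) {t} (by simp) hw
    exact h0.comp
      (φ := fun (x : Finset.range t → W) i => pattern D (x i))
      (ψ := fun (x : ({t} : Finset ℕ) → W) => x ⟨t, Finset.mem_singleton_self t⟩)
      (measurable_pi_lambda _ fun i => (measurable_pattern D).comp (measurable_pi_apply i))
      (measurable_pi_apply _)
  have hmap := (indepFun_iff_map_prod_eq_prod_map_map hHm.aemeasurable (hw t).aemeasurable).1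
    hindep
  have hΦ : Measurable fun x : (Finset.range t → Fin n → Fin n → Bool) × W => φ (g x.1) x.2 :=
    measurable_from_prod_countable_right fun a => hφ (g a)
  have h1 := lintegral_map (μ := μ) hΦ (hHm.prodMk (hw t))
  rw [hmap, hlaw, lintegral_prod _ hΦ.aemeasurable,
    lintegral_map (measurable_of_countable _) hHm] at h1
  exact h1.symm

end History

theorem measurable_mixture {ι : Type*} [Fintype ι] (R m : ℝ) (μ : ι → ℝ) (N : ℕ) :
    Measurable (mixture R m μ N) := by
  unfold mixture
  refine Measurable.lintegral_prod_right' (f := fun x : (ι → ℝ) × (ι → ℝ) =>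
    ENNReal.ofReal (Real.exp (∑ i, (x.2 i * x.1 i - R * (N * μ i) / 2 * x.2 i ^ 2)))) ?_
  fun_prop

/-! ### Ville's inequality and self-normalized deviations -/

section Maximal

variable {n : ℕ} {W Ω : Type*} [MeasurableSpace W] [MeasurableSpace Ω] {D : DiffusionModel n W}

open Classical in
/-- The number of rounds before `t` in which `A` holds. -/
noncomputable def countBefore (A : ℕ → Prop) (t : ℕ) : ℕ := ((Finset.range t).filter A).card

open Classical in
/-- The sum of `x` over the rounds before `t` in which `A` holds. -/
noncomputable def sumBefore {V : Type*} [AddCommMonoid V] (A : ℕ → Prop) (x : ℕ → V) (t : ℕ) : V :=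
  ∑ s ∈ (Finset.range t).filter A, x s

open Classical in
theorem countBefore_succ (A : ℕ → Prop) (t : ℕ) :
    countBefore A (t + 1) = if A t then countBefore A t + 1 else countBefore A t := by
  unfold countBefore
  rw [Finset.range_add_one, Finset.filter_insert]
  split_ifs
  · rw [Finset.card_insert_of_notMem (by simp)]
  · rfl

open Classical in
theorem sumBefore_succ {V : Type*} [AddCommMonoid V] (A : ℕ → Prop) (x : ℕ → V) (t : ℕ) :
    sumBefore A x (t + 1) = if A t then sumBefore A x t + x t else sumBefore A x t := by
  unfold sumBefore
  rw [Finset.range_add_one, Finset.filter_insert]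
  split_ifs
  · rw [Finset.sum_insert (by simp), add_comm]
  · rfl

open Classical in
theorem countBefore_congr {A B : ℕ → Prop} {t : ℕ} (h : ∀ s < t, A s ↔ B s) :
    countBefore A t = countBefore B t := by
  unfold countBefore
  congr 1
  exact Finset.filter_congr fun s hs => h s (Finset.mem_range.1 hs)

open Classical in
theorem sumBefore_congr {V : Type*} [AddCommMonoid V] {A B : ℕ → Prop} {x y : ℕ → V} {t : ℕ}
    (h : ∀ s < t, A s ↔ B s) (hx : ∀ s < t, x s = y s) :
    sumBefore A x t = sumBefore B y t := by
  unfold sumBefore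
  refine Finset.sum_congr (Finset.filter_congr fun s hs => h s (Finset.mem_range.1 hs)) ?_
  intro s hs
  exact hx s (Finset.mem_range.1 (Finset.mem_filter.1 hs).1)

open Classical in
theorem countBefore_le (A : ℕ → Prop) (t : ℕ) : countBefore A t ≤ t := by
  unfold countBefore
  exact (Finset.card_filter_le _ _).trans (by simp)

/-- Ville's inequality for the mixture supermartingale of a predictable selection of rounds. -/
theorem measure_mixture_ge_le {μ : Measure Ω} [IsProbabilityMeasure μ] {w : ℕ → Ω → W}
    (hw : ∀ t, Measurable (w t)) (hlaw : ∀ t, μ.map (w t) = D.law) (hind : iIndepFun w μ)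
    {A : ℕ → Ω → Prop} (hA : ∀ t, DependsOnPast D w t (A t))
    {ι : Type*} [Fintype ι] {η : W → ι → ℝ} (hη : Measurable η)
    (hηp : ∀ z z', pattern D z = pattern D z' → η z = η z')
    {R m : ℝ} {ν : ι → ℝ}
    (hsub : ∀ g : ι → ℝ, ∫⁻ z, ENNReal.ofReal (Real.exp (∑ i, g i * η z i)) ∂D.law ≤
      ENNReal.ofReal (Real.exp (R / 2 * ∑ i, ν i * g i ^ 2)))
    (q : ℝ) (T : ℕ) :
    μ {ω | ∃ t ≤ T, ENNReal.ofReal (Real.exp q) ≤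
      mixture R m ν (countBefore (fun s => A s ω) t)
        (sumBefore (fun s => A s ω) (fun s => η (w s ω)) t)} ≤
      ENNReal.ofReal (Real.exp (-q)) := by
  classical
  have : Nonempty Ω := nonempty_of_isProbabilityMeasure μ
  have := D.isProbabilityMeasure
  set N : ℕ → Ω → ℕ := fun t ω => countBefore (fun s => A s ω) t with hN
  set ξ : ℕ → Ω → ι → ℝ := fun t ω => sumBefore (fun s => A s ω) (fun s => η (w s ω)) t with hξ
  set U : ℕ → Ω → ℝ≥0∞ := fun t ω => mixture R m ν (N t ω) (ξ t ω) with hU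
  set C := ENNReal.ofReal (Real.exp q) with hC
  have hC0 : C ≠ 0 := by simp [hC, Real.exp_pos]
  have hCt : C ≠ ⊤ := ENNReal.ofReal_ne_top
  have hNd : ∀ t, DependsOnPast D w t (N t) := fun t ω ω' h =>
    countBefore_congr fun s hs => iff_of_eq ((hA s).mono hs.le ω ω' h)
  have hξd : ∀ t, DependsOnPast D w t (ξ t) := fun t ω ω' h =>
    sumBefore_congr (fun s hs => iff_of_eq ((hA s).mono hs.le ω ω' h))
      fun s hs => hηp _ _ (h s hs)
  have hUd : ∀ t, DependsOnPast D w t (U t) := fun t ω ω' h => by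
    simp only [hU, hNd t ω ω' h, hξd t ω ω' h]
  set E : ℕ → Ω → Prop := fun t ω => ∃ s ≤ t, C ≤ U s ω with hE
  have hEd : ∀ t, DependsOnPast D w t (E t) := fun t ω ω' h => by
    simp only [hE, eq_iff_iff]
    refine exists_congr fun s => and_congr_right fun hs => ?_
    rw [(hUd s).mono hs ω ω' h]
  -- The mixture frozen at the level C from its first crossing on: its integral stays at most 1, and
  -- Markov's inequality at time T then controls all earlier times.
  set G : ℕ → Ω → ℝ≥0∞ := fun t ω => if E t ω then C else U t ω with hG
  have hGd : ∀ t, DependsOnPast D w t (G t) := fun t ω ω' h => by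
    simp only [hG, hUd t ω ω' h, hEd t ω ω' h]
  have hle : ∀ t, ∫⁻ ω, G t ω ∂μ ≤ 1 := by
    intro t
    induction t with
    | zero =>
      calc ∫⁻ ω, G 0 ω ∂μ ≤ ∫⁻ _ω, 1 ∂μ := by
            refine lintegral_mono fun ω => ?_
            have h1 : U 0 ω = 1 := by
              simp only [hU, hN, hξ, countBefore, sumBefore, Finset.range_zero,
                Finset.filter_empty, Finset.card_empty, Finset.sum_empty]
              exact mixture_zero
            simp only [hG]
            split_ifs with hc
            · obtain ⟨s, hs, hs'⟩ := hc
              rw [Nat.le_zero.1 hs, h1] at hs'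
              exact hs'
            · exact h1.le
        _ = 1 := by simp
    | succ t ih =>
      refine le_trans ?_ ih
      -- Everything known before round t, gathered in one value so that the fresh realization can be
      -- averaged out.
      set f : Ω → Prop × Prop × ℕ × (ι → ℝ) := fun ω => (E t ω, A t ω, N t ω, ξ t ω) with hf
      have hfd : DependsOnPast D w t f := fun ω ω' h => by
        simp only [hf, hEd t ω ω' h, hA t ω ω' h, hNd t ω ω' h, hξd t ω ω' h]
      set φ : Prop × Prop × ℕ × (ι → ℝ) → W → ℝ≥0∞ := fun b z =>
        if b.1 then C else if b.2.1 then mixture R m ν (b.2.2.1 + 1) (b.2.2.2 + η z)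
          else mixture R m ν b.2.2.1 b.2.2.2 with hφ
      have hφm : ∀ b, Measurable (φ b) := by
        intro b
        simp only [hφ]
        split_ifs
        · exact measurable_const
        · exact (measurable_mixture R m ν _).comp (hη.const_add _)
        · exact measurable_const
      calc ∫⁻ ω, G (t + 1) ω ∂μ ≤ ∫⁻ ω, φ (f ω) (w t ω) ∂μ := by
            refine lintegral_mono fun ω => ?_
            have hUs : U (t + 1) ω = if A t ω then mixture R m ν (N t ω + 1)
                (ξ t ω + η (w t ω)) else mixture R m ν (N t ω) (ξ t ω) := by
              simp only [hU, hN, hξ, countBefore_succ, sumBefore_succ]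
              split_ifs <;> rfl
            simp only [hG, hφ, hf]
            by_cases hEt : E t ω
            · rw [if_pos hEt, if_pos]
              obtain ⟨s, hs, hs'⟩ := hEt
              exact ⟨s, hs.trans (Nat.le_succ t), hs'⟩
            · rw [if_neg hEt, ← hUs]
              split_ifs with hc
              · obtain ⟨s, hs, hs'⟩ := hc
                rcases Nat.le_succ_iff.1 hs with h | h
                · exact absurd ⟨s, h, hs'⟩ hEt
                · rw [h] at hs'
                  exact hs'
              · exact le_rfl
        _ = ∫⁻ ω, ∫⁻ z, φ (f ω) z ∂D.law ∂μ := hfd.lintegral_eq hw hlaw hind hφm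
        _ ≤ ∫⁻ ω, G t ω ∂μ := by
            refine lintegral_mono fun ω => ?_
            simp only [hG, hφ, hf]
            split_ifs
            · simp
            · exact lintegral_mixture_le hη hsub _ _
            · simp [hU]
  have hsubset : {ω | ∃ t ≤ T, C ≤ U t ω} ⊆ {ω | C ≤ G T ω} := by
    intro ω hω
    have hω' : E T ω := hω
    change C ≤ if E T ω then C else U T ω
    rw [if_pos hω']
  refine (measure_mono hsubset).trans ?_
  have hmk := mul_meas_ge_le_lintegral ((hGd T).measurable (β := ℝ≥0∞) hw) C (μ := μ)
  have h1 := hmk.trans (hle T)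
  rw [Real.exp_neg, ENNReal.ofReal_inv_of_pos (Real.exp_pos _), ← hC]
  rw [← ENNReal.mul_le_mul_iff_right hC0 hCt, ENNReal.mul_inv_cancel hC0 hCt]
  exact h1

/-- Time-uniform self-normalized deviation bound. -/
theorem measure_exists_lt_sum_sq_div_le {μ : Measure Ω} [IsProbabilityMeasure μ] {w : ℕ → Ω → W}
    (hw : ∀ t, Measurable (w t)) (hlaw : ∀ t, μ.map (w t) = D.law) (hind : iIndepFun w μ)
    {A : ℕ → Ω → Prop} (hA : ∀ t, DependsOnPast D w t (A t))
    {ι : Type*} [Fintype ι] {η : W → ι → ℝ} (hη : Measurable η)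
    (hηp : ∀ z z', pattern D z = pattern D z' → η z = η z')
    {R m : ℝ} {ν : ι → ℝ} (hR : 0 < R) (hm : 0 < m) (hν : ∀ i, 0 ≤ ν i)
    (hsub : ∀ g : ι → ℝ, ∫⁻ z, ENNReal.ofReal (Real.exp (∑ i, g i * η z i)) ∂D.law ≤
      ENNReal.ofReal (Real.exp (R / 2 * ∑ i, ν i * g i ^ 2)))
    (q : ℝ) (T : ℕ) :
    μ {ω | ∃ t ≤ T, R * (2 * q +
        ∑ i, Real.log (1 + countBefore (fun s => A s ω) t * ν i / m)) <
      ∑ i, (sumBefore (fun s => A s ω) (fun s => η (w s ω)) t i) ^ 2 /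
        (m + countBefore (fun s => A s ω) t * ν i)} ≤
      ENNReal.ofReal (Real.exp (-q)) := by
  refine (measure_mono ?_).trans
    (measure_mixture_ge_le (R := R) (m := m) (ν := ν) hw hlaw hind hA hη hηp hsub q T)
  rintro ω ⟨t, ht, hlt⟩
  refine ⟨t, ht, ?_⟩
  by_contra hcon
  exact absurd (sum_sq_div_le_of_mixture_lt hR hm hν (not_le.1 hcon)) (not_le.2 hlt)

end Maximal

end IMBandit

namespace IMBandit

/-! ### The surrogate objective -/

section Surrogate

variable {n : ℕ} {S : Finset (Fin n)} {p q : Fin n → Fin n → ℝ}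

theorem surrogate_le_sum {g : Fin n → ℝ} (hg : ∀ v, 0 ≤ g v) (h : ∀ u ∈ S, ∀ v, p u v ≤ g v) :
    surrogate S p ≤ ∑ v, g v := by
  refine Finset.sum_le_sum fun v _ => ?_
  split_ifs with hS
  · exact Finset.sup'_le _ _ fun u hu => h u hu v
  · exact hg v

theorem surrogate_mono (h : ∀ u ∈ S, ∀ v, p u v ≤ q u v) : surrogate S p ≤ surrogate S q := by
  refine Finset.sum_le_sum fun v _ => ?_
  split_ifs with hS
  · exact Finset.sup'_le _ _ fun u hu =>
      (h u hu v).trans (Finset.le_sup' (fun u => q u v) hu)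
  · exact le_rfl

theorem surrogate_nonneg (h : ∀ u ∈ S, ∀ v, 0 ≤ p u v) : 0 ≤ surrogate S p := by
  refine Finset.sum_nonneg fun v _ => ?_
  split_ifs with hS
  · obtain ⟨u, hu⟩ := hS
    exact (h u hu v).trans (Finset.le_sup' (fun u => p u v) hu)
  · exact le_rfl

/-- At each node the error of the maximizing source is one term of the nonnegative sum over `S`. -/
theorem surrogate_le_add {r : Fin n → Fin n → ℝ} (hr : ∀ u ∈ S, ∀ v, 0 ≤ r u v)
    (h : ∀ u ∈ S, ∀ v, q u v ≤ p u v + r u v) :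
    surrogate S q ≤ surrogate S p + ∑ u ∈ S, ∑ v, r u v := by
  rw [Finset.sum_comm, surrogate, surrogate, ← Finset.sum_add_distrib]
  refine Finset.sum_le_sum fun v _ => ?_
  split_ifs with hS
  · refine Finset.sup'_le _ _ fun u hu => (h u hu v).trans ?_
    exact add_le_add (Finset.le_sup' (fun u => p u v) hu)
      (Finset.single_le_sum (f := fun u => r u v) (fun u hu => hr u hu v) hu)
  · have hS' := Finset.not_nonempty_iff_eq_empty.1 hS
    simp [hS']

variable {W : Type*} [MeasurableSpace W] {D : DiffusionModel n W}

theorem surrogate_le_spread (hmono : D.IsMonotone) (S : Finset (Fin n)) :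
    surrogate S D.pairwiseReach ≤ D.spread S :=
  surrogate_le_sum (fun v => (influenceProb_mem_Icc D S v).1)
    fun _ hu v => hmono v _ _ (Finset.singleton_subset_iff.2 hu)

theorem spread_nonneg (S : Finset (Fin n)) : 0 ≤ D.spread S :=
  Finset.sum_nonneg fun v _ => (influenceProb_mem_Icc D S v).1

theorem spread_le (S : Finset (Fin n)) : D.spread S ≤ n := by
  calc D.spread S ≤ ∑ _v : Fin n, (1 : ℝ) :=
        Finset.sum_le_sum fun v _ => (influenceProb_mem_Icc D S v).2
    _ = n := by simp

end Surrogate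

/-! ### Closed form of the algorithm and regret on the confidence event -/

section Algorithm

variable {n d : ℕ} {W : Type*} [MeasurableSpace W] (P : IMProblem n W) (oracle : Oracle n)
  (X : Matrix (Fin d) (Fin n) ℝ) (c lam σ : ℝ)

theorem stateAfter_congr {w w' : ℕ → W} {t : ℕ}
    (h : ∀ i < t, pattern P.diffusion (w i) = pattern P.diffusion (w' i)) :
    stateAfter P oracle X c lam σ w t = stateAfter P oracle X c lam σ w' t := by
  induction t with
  | zero => rfl
  | succ t ih =>
    have ht := ih fun i hi => h i (hi.trans (Nat.lt_succ_self t))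
    have hr : (fun u v => P.diffusion.reach {u} v (w t)) =
        fun u v => P.diffusion.reach {u} v (w' t) := by
      funext u v
      exact reach_congr P.diffusion (h t (Nat.lt_succ_self t)) u v
    simp only [stateAfter, ht, hr]

variable (w : ℕ → W)

/-- The number of times the source `u` has been played in the first `t` rounds. -/
noncomputable def plays (t : ℕ) (u : Fin n) : ℕ :=
  countBefore (fun s => u ∈ seedSet P oracle X c lam σ w s) t

/-- The sum of the centered feedback of the source `u` in the first `t` rounds. -/
noncomputable def noiseSum (t : ℕ) (u : Fin n) : Fin n → ℝ :=
  sumBefore (fun s => u ∈ seedSet P oracle X c lam σ w s)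
    (fun s => noise P.diffusion u (w s)) t

theorem stateAfter_gram_b (t : ℕ) (u : Fin n) :
    (stateAfter P oracle X c lam σ w t).gram u = lam • (1 : Matrix (Fin d) (Fin d) ℝ) +
      (plays P oracle X c lam σ w t u * (σ ^ 2)⁻¹) • (X * X.transpose) ∧
    (stateAfter P oracle X c lam σ w t).b u = X.mulVec (noiseSum P oracle X c lam σ w t u +
      (plays P oracle X c lam σ w t u : ℝ) • fun v => P.diffusion.pairwiseReach u v) := by
  induction t with
  | zero => simp [stateAfter, initState, plays, noiseSum, countBefore, sumBefore]
  | succ t ih =>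
    obtain ⟨h1, h2⟩ := ih
    have hN := countBefore_succ (fun s => u ∈ seedSet P oracle X c lam σ w s) t
    have hs := sumBefore_succ (fun s => u ∈ seedSet P oracle X c lam σ w s)
      (fun s => noise P.diffusion u (w s)) t
    by_cases hu : u ∈ seedSet P oracle X c lam σ w t
    · rw [if_pos hu] at hN hs
      have hu' : u ∈ oracle P.graph P.feasible (stateAfter P oracle X c lam σ w t).ucb := hu
      simp only [stateAfter, update, if_pos hu']
      rw [h1, h2]
      simp only [plays, noiseSum, hN, hs]
      constructor
      · push_cast
        module
      · rw [← Matrix.mulVec_add]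
        congr 1
        funext v
        simp only [noise, Pi.add_apply, Pi.smul_apply, smul_eq_mul]
        push_cast
        ring
    · rw [if_neg hu] at hN hs
      have hu' : u ∉ oracle P.graph P.feasible (stateAfter P oracle X c lam σ w t).ucb := hu
      simp only [stateAfter, update, if_neg hu']
      rw [h1, h2]
      simp only [plays, noiseSum, hN, hs]
      exact ⟨trivial, trivial⟩

theorem stateAfter_ucb_of_plays_eq_zero {t : ℕ} {u : Fin n}
    (h : plays P oracle X c lam σ w t u = 0) (v : Fin n) :
    (stateAfter P oracle X c lam σ w t).ucb u v = 1 := by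
  induction t with
  | zero => rfl
  | succ t ih =>
    have hN := countBefore_succ (fun s => u ∈ seedSet P oracle X c lam σ w s) t
    by_cases hu : u ∈ seedSet P oracle X c lam σ w t
    · rw [if_pos hu] at hN
      rw [plays, hN] at h
      omega
    · rw [if_neg hu] at hN
      have hu' : u ∉ oracle P.graph P.feasible (stateAfter P oracle X c lam σ w t).ucb := hu
      simp only [stateAfter, update, if_neg hu']
      exact ih (by rwa [plays, hN] at h)

/-- The Gram matrix and `b` have not changed since the last play of `u`, so the stored index agrees
with its value from the current variables. -/
theorem stateAfter_ucb_of_plays_ne_zero {t : ℕ} {u : Fin n}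
    (h : plays P oracle X c lam σ w t u ≠ 0) (v : Fin n) :
    (stateAfter P oracle X c lam σ w t).ucb u v =
      (Set.projIcc (0 : ℝ) 1 zero_le_one
        (dotProduct ((σ ^ 2)⁻¹ • (((stateAfter P oracle X c lam σ w t).gram u)⁻¹).mulVec
          ((stateAfter P oracle X c lam σ w t).b u)) (fun i => X i v) +
        c * Real.sqrt (dotProduct (fun i => X i v)
          ((((stateAfter P oracle X c lam σ w t).gram u)⁻¹).mulVec (fun i => X i v)))) : ℝ) := by
  induction t with
  | zero => simp [plays, countBefore] at h
  | succ t ih =>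
    have hN := countBefore_succ (fun s => u ∈ seedSet P oracle X c lam σ w s) t
    by_cases hu : u ∈ seedSet P oracle X c lam σ w t
    · have hu' : u ∈ oracle P.graph P.feasible (stateAfter P oracle X c lam σ w t).ucb := hu
      simp only [stateAfter, update, if_pos hu']
    · rw [if_neg hu] at hN
      have hu' : u ∉ oracle P.graph P.feasible (stateAfter P oracle X c lam σ w t).ucb := hu
      simp only [stateAfter, update, if_neg hu']
      exact ih (by rwa [plays, hN] at h)

theorem stateAfter_ucb_mem_Icc (t : ℕ) (u v : Fin n) :
    (stateAfter P oracle X c lam σ w t).ucb u v ∈ Set.Icc (0 : ℝ) 1 := by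
  by_cases h : plays P oracle X c lam σ w t u = 0
  · rw [stateAfter_ucb_of_plays_eq_zero P oracle X c lam σ w h]
    simp
  · rw [stateAfter_ucb_of_plays_ne_zero P oracle X c lam σ w h]
    exact Subtype.coe_prop _

/-- Clipping is harmless because the target p itself lies in [0,1]. -/
theorem projIcc_add_mem_Icc {a p r : ℝ} (hp : p ∈ Set.Icc (0 : ℝ) 1) (h1 : -r ≤ a - p)
    (h2 : a - p ≤ r) :
    (Set.projIcc (0 : ℝ) 1 zero_le_one (a + r) : ℝ) ∈ Set.Icc p (p + 2 * r) := by
  rw [Set.coe_projIcc]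
  constructor
  · refine le_max_of_le_right (le_min hp.2 ?_)
    linarith
  · refine max_le ?_ ((min_le_right _ _).trans ?_)
    · linarith [hp.1]
    · linarith

/-- The error of the estimate of `p*(u, v)` after `t` rounds. -/
noncomputable def estimationError (θ : Fin n → EuclideanSpace ℝ (Fin d)) (t : ℕ) (u v : Fin n) :
    ℝ :=
  ∑ i, coord X (fun k => X k v) i *
    ((coord X (X.mulVec (noiseSum P oracle X c lam σ w t u)) i -
      lam * σ ^ 2 * coord X (θ u).ofLp i) /
      (lam * σ ^ 2 + plays P oracle X c lam σ w t u * eigval X i))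

/-- The width of the confidence interval for `p*(u, v)` after `t` rounds. -/
noncomputable def width (t : ℕ) (u v : Fin n) : ℝ :=
  σ * Real.sqrt (widthSq X (lam * σ ^ 2) (plays P oracle X c lam σ w t u) v)

/-- All the confidence intervals of the played sources are valid after `t` rounds. -/
def IsConfident (θ : Fin n → EuclideanSpace ℝ (Fin d)) (t : ℕ) : Prop :=
  ∀ u v, |estimationError P oracle X c lam σ w θ t u v| ≤ c * width P oracle X c lam σ w t u v

theorem width_nonneg (hσ : 0 < σ) (t : ℕ) (u v : Fin n) : 0 ≤ width P oracle X c lam σ w t u v :=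
  mul_nonneg hσ.le (Real.sqrt_nonneg _)

variable {P oracle X c lam σ w} {θ : Fin n → EuclideanSpace ℝ (Fin d)}

theorem ucb_mem_Icc_of_isConfident (hlam : 0 < lam) (hσ : 0 < σ)
    (hlin : ∀ u v, P.diffusion.pairwiseReach u v = inner ℝ (θ u) (feature X v)) {t : ℕ}
    (hconf : IsConfident P oracle X c lam σ w θ t) {u : Fin n}
    (hu : plays P oracle X c lam σ w t u ≠ 0) (v : Fin n) :
    (stateAfter P oracle X c lam σ w t).ucb u v ∈
      Set.Icc (P.diffusion.pairwiseReach u v)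
        (P.diffusion.pairwiseReach u v + 2 * c * width P oracle X c lam σ w t u v) := by
  have hp := influenceProb_mem_Icc P.diffusion {u} v
  change P.diffusion.pairwiseReach u v ∈ _ at hp
  obtain ⟨hG, hb⟩ := stateAfter_gram_b P oracle X c lam σ w t u
  rw [stateAfter_ucb_of_plays_ne_zero P oracle X c lam σ w hu, hG, hb,
    sqrt_dotProduct_inv_mulVec X hlam hσ]
  have he := estimate_sub_eq X hlam hσ (hlin u) (plays P oracle X c lam σ w t u)
    (noiseSum P oracle X c lam σ w t u) v
  have herr := abs_le.1 (hconf u v)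
  change _ = estimationError P oracle X c lam σ w θ t u v at he
  change -(c * width P oracle X c lam σ w t u v) ≤ _ ∧ _ at herr
  rw [← he] at herr
  have hw : σ * Real.sqrt (widthSq X (lam * σ ^ 2) (plays P oracle X c lam σ w t u) v) =
    width P oracle X c lam σ w t u v := rfl
  rw [hw]
  rw [mul_assoc 2 c]
  exact projIcc_add_mem_Icc hp herr.1 herr.2

/-- The per-round regret bound on the confidence event. -/
theorem round_regret_le (hmono : P.diffusion.IsMonotone) {Sstar Stilde : Finset (Fin n)}
    (hSt : Stilde ∈ P.feasible)
    {ρ : ℝ}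
    (hρF : ρ * P.diffusion.spread Sstar = surrogate Stilde P.diffusion.pairwiseReach)
    (hlin : ∀ u v, P.diffusion.pairwiseReach u v = inner ℝ (θ u) (feature X v))
    {α : ℝ} (hα_pos : 0 < α) (hα_le : α ≤ 1)
    (horacle : IsApproxOracle oracle P.graph P.feasible α)
    (hlam : 0 < lam) (hσ : 0 < σ) {Θ : ℝ} (hΘ : ∀ u, ‖θ u‖ ≤ Θ) (hΘ0 : 0 ≤ Θ)
    (hc : Real.sqrt lam * Θ ≤ c) {t : ℕ} (hconf : IsConfident P oracle X c lam σ w θ t) :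
    ρ * α * P.diffusion.spread Sstar -
        P.diffusion.spread (seedSet P oracle X c lam σ w t) ≤
      2 * c * ∑ u ∈ seedSet P oracle X c lam σ w t, ∑ v, width P oracle X c lam σ w t u v := by
  have hc0 : 0 ≤ c := (mul_nonneg (Real.sqrt_nonneg _) hΘ0).trans hc
  set S := seedSet P oracle X c lam σ w t with hS
  have hp0 : ∀ u v, 0 ≤ P.diffusion.pairwiseReach u v := fun u v =>
    (influenceProb_mem_Icc P.diffusion {u} v).1
  have hf0 : 0 ≤ surrogate Stilde P.diffusion.pairwiseReach :=
    surrogate_nonneg fun u _ v => hp0 u v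
  have hw0 := width_nonneg P oracle X c lam σ w hσ t
  rw [mul_right_comm, hρF]
  -- A first play has index 1 by default, possibly above p* + 2c · width. Such a round is charged
  -- entirely to the initial widths ‖x_v‖ / √λ of that source.
  by_cases hplayed : ∃ u ∈ S, plays P oracle X c lam σ w t u = 0
  · obtain ⟨u, hu, hN⟩ := hplayed
    have h1 : surrogate Stilde P.diffusion.pairwiseReach ≤ ∑ v, Θ * ‖feature X v‖ := by
      refine surrogate_le_sum (fun v => by positivity) fun u' _ v => ?_
      rw [hlin]
      exact (real_inner_le_norm _ _).trans (by gcongr; exact hΘ u')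
    have h2 : ∀ v, Θ * ‖feature X v‖ ≤ c * width P oracle X c lam σ w t u v := by
      intro v
      rw [width, hN, widthSq_zero X, Real.sqrt_div (sq_nonneg _), Real.sqrt_sq (norm_nonneg _),
        Real.sqrt_mul hlam.le, Real.sqrt_sq hσ.le]
      have hl : 0 < Real.sqrt lam := Real.sqrt_pos.2 hlam
      have h3 : c * (σ * (‖feature X v‖ / (Real.sqrt lam * σ))) =
          c / Real.sqrt lam * ‖feature X v‖ := by field_simp
      rw [h3]
      refine mul_le_mul_of_nonneg_right ?_ (norm_nonneg _)
      rw [le_div_iff₀ hl]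
      linarith
    have h3 : ∑ v, width P oracle X c lam σ w t u v ≤
        ∑ u ∈ S, ∑ v, width P oracle X c lam σ w t u v :=
      Finset.single_le_sum (f := fun u => ∑ v, width P oracle X c lam σ w t u v)
        (fun u _ => Finset.sum_nonneg fun v _ => hw0 u v) hu
    have h4 := h1.trans (Finset.sum_le_sum fun v _ => h2 v)
    rw [← Finset.mul_sum] at h4
    have h5 := mul_le_mul_of_nonneg_left h3 hc0
    have h6 : 0 ≤ c * ∑ v, width P oracle X c lam σ w t u v :=
      mul_nonneg hc0 (Finset.sum_nonneg fun v _ => hw0 u v)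
    have h7 := spread_nonneg (D := P.diffusion) S
    have h8 := mul_le_of_le_one_right hf0 hα_le
    linarith
  · push Not at hplayed
    set p := (stateAfter P oracle X c lam σ w t).ucb with hp
    have hopt : ∀ u v, P.diffusion.pairwiseReach u v ≤ p u v := by
      intro u v
      by_cases hN : plays P oracle X c lam σ w t u = 0
      · rw [hp, stateAfter_ucb_of_plays_eq_zero P oracle X c lam σ w hN]
        exact (influenceProb_mem_Icc P.diffusion {u} v).2
      · exact (ucb_mem_Icc_of_isConfident hlam hσ hlin hconf hN v).1
    have h1 : surrogate Stilde P.diffusion.pairwiseReach ≤ surrogate Stilde p :=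
      surrogate_mono fun u _ v => hopt u v
    have h2 := (horacle p (stateAfter_ucb_mem_Icc P oracle X c lam σ w t)).2 Stilde hSt
    change _ ≤ surrogate S p at h2
    have h3 : surrogate S p ≤ surrogate S P.diffusion.pairwiseReach +
        ∑ u ∈ S, ∑ v, 2 * c * width P oracle X c lam σ w t u v :=
      surrogate_le_add (fun u _ v => mul_nonneg (by positivity) (hw0 u v)) fun u hu v =>
        (ucb_mem_Icc_of_isConfident hlam hσ hlin hconf (hplayed u hu) v).2
    have h4 := surrogate_le_spread hmono S
    simp_rw [← Finset.mul_sum] at h3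
    have h5 := mul_le_mul_of_nonneg_left h1 hα_pos.le
    linarith

-- Reindexes the rounds in which a source is played by its play number, so that the elliptical
-- potential applies source by source.
open Classical in
theorem sum_range_ite_countBefore (A : ℕ → Prop) (φ : ℕ → ℝ) (T : ℕ) :
    ∑ t ∈ Finset.range T, (if A t then φ (countBefore A t) else 0) =
      ∑ j ∈ Finset.range (countBefore A T), φ j := by
  induction T with
  | zero => simp [countBefore]
  | succ T ih =>
    rw [Finset.sum_range_succ, ih, countBefore_succ]
    split_ifs
    · rw [Finset.sum_range_succ]
    · rw [add_zero]

/-- The sum of the widths of the played sources, by the Cauchy-Schwarz inequality. -/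
theorem sum_width_le (hlam : 0 < lam) (hσ : 0 < σ) {K T : ℕ} {Q : ℝ}
    (hK : ∀ t < T, (seedSet P oracle X c lam σ w t).card ≤ K)
    (hQ : ∀ M ≤ T, ∑ j ∈ Finset.range M, ∑ v, widthSq X (lam * σ ^ 2) j v ≤ Q) :
    ∑ t ∈ Finset.range T, ∑ u ∈ seedSet P oracle X c lam σ w t, ∑ v,
      width P oracle X c lam σ w t u v ≤ σ * Real.sqrt (T * K * n * (n * Q)) := by
  classical
  have hm : 0 < lam * σ ^ 2 := by positivity
  set S := seedSet P oracle X c lam σ w with hS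
  set I := (Finset.range T).sigma fun t => S t ×ˢ (Finset.univ : Finset (Fin n)) with hI
  have hsum : ∀ f : ℕ → Fin n → Fin n → ℝ, ∑ x ∈ I, f x.1 x.2.1 x.2.2 =
      ∑ t ∈ Finset.range T, ∑ u ∈ S t, ∑ v, f t u v := by
    intro f
    rw [hI, Finset.sum_sigma]
    refine Finset.sum_congr rfl fun t _ => ?_
    rw [Finset.sum_product]
  have hcard : (I.card : ℝ) ≤ T * K * n := by
    have : I.card ≤ T * K * n := by
      rw [hI, Finset.card_sigma]
      calc ∑ t ∈ Finset.range T, (S t ×ˢ (Finset.univ : Finset (Fin n))).card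
          ≤ ∑ _t ∈ Finset.range T, K * n := by
            refine Finset.sum_le_sum fun t ht => ?_
            rw [Finset.card_product, Finset.card_univ, Fintype.card_fin]
            exact Nat.mul_le_mul_right _ (hK t (Finset.mem_range.1 ht))
        _ = T * K * n := by simp [mul_assoc]
    exact_mod_cast this
  have hsq : ∑ t ∈ Finset.range T, ∑ u ∈ S t, ∑ v,
      widthSq X (lam * σ ^ 2) (plays P oracle X c lam σ w t u) v ≤ n * Q := by
    -- Extending the sum to all sources allows exchanging it with the sum over rounds; each of the n
    -- sources then contributes at most `Q`.
    have h1 : ∀ t, ∑ u ∈ S t, ∑ v,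
        widthSq X (lam * σ ^ 2) (plays P oracle X c lam σ w t u) v =
        ∑ u, if u ∈ S t then
          ∑ v, widthSq X (lam * σ ^ 2) (plays P oracle X c lam σ w t u) v else 0 := by
      intro t
      rw [Finset.sum_ite_mem, Finset.univ_inter]
    simp_rw [h1]
    rw [Finset.sum_comm]
    calc _ ≤ ∑ _u : Fin n, Q := by
          refine Finset.sum_le_sum fun u _ => ?_
          have h2 := sum_range_ite_countBefore (fun s => u ∈ S s)
            (fun j => ∑ v, widthSq X (lam * σ ^ 2) j v) T
          refine le_trans (le_of_eq ?_) (hQ _ (countBefore_le (fun s => u ∈ S s) T))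
          rw [← h2]
          refine Finset.sum_congr rfl fun t _ => ?_
          split_ifs <;> rfl
      _ = n * Q := by simp
  have hcs := sq_sum_le_card_mul_sum_sq (s := I) (f := fun x =>
    Real.sqrt (widthSq X (lam * σ ^ 2) (plays P oracle X c lam σ w x.1 x.2.1) x.2.2))
  simp_rw [Real.sq_sqrt (widthSq_nonneg X hm _ _)] at hcs
  rw [hsum fun t u v => widthSq X (lam * σ ^ 2) (plays P oracle X c lam σ w t u) v,
    hsum fun t u v => Real.sqrt (widthSq X (lam * σ ^ 2) (plays P oracle X c lam σ w t u) v)]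
    at hcs
  simp only [width, ← Finset.mul_sum]
  refine mul_le_mul_of_nonneg_left (Real.le_sqrt_of_sq_le (hcs.trans ?_)) hσ.le
  refine mul_le_mul hcard hsq ?_ (by positivity)
  exact Finset.sum_nonneg fun t _ => Finset.sum_nonneg fun u _ => Finset.sum_nonneg fun v _ =>
    widthSq_nonneg X hm _ _

end Algorithm

end IMBandit

namespace IMBandit

open scoped ENNReal

/-! ### From confidence to regret -/

section Regret

variable {n d : ℕ} {W Ω : Type*} [MeasurableSpace W] (P : IMProblem n W)
  (oracle : Oracle n) (X : Matrix (Fin d) (Fin n) ℝ) (c lam σ : ℝ) (w : ℕ → Ω → W)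

theorem dependsOnPast_seedSet (t : ℕ) :
    DependsOnPast P.diffusion w t
      (fun ω => seedSet P oracle X c lam σ (fun s => w s ω) t) := by
  intro ω ω' h
  simp only [seedSet]
  rw [stateAfter_congr P oracle X c lam σ (w := fun s => w s ω) (w' := fun s => w s ω') h]

theorem dependsOnPast_mem_seedSet (u : Fin n) (t : ℕ) :
    DependsOnPast P.diffusion w t
      (fun ω => u ∈ seedSet P oracle X c lam σ (fun s => w s ω) t) := by
  intro ω ω' h
  have := dependsOnPast_seedSet P oracle X c lam σ w t ω ω' h
  exact congrArg (u ∈ ·) this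

variable {P oracle X c lam σ w} [MeasurableSpace Ω] {μ : Measure Ω}

/-- The measurable hull has the same measure, so the exceptional set need not be measurable. -/
theorem integral_le_of_exceptional [IsProbabilityMeasure μ] {f : Ω → ℝ} (hf : Integrable f μ)
    {E : Set Ω} {B M ε : ℝ} (hB : 0 ≤ B) (hM : 0 ≤ M) (hε : 0 ≤ ε) (hE : μ E ≤ ENNReal.ofReal ε)
    (hgood : ∀ ω ∉ E, f ω ≤ B) (hall : ∀ ω, f ω ≤ M) : ∫ ω, f ω ∂μ ≤ B + ε * M := by
  have hmeas := measurableSet_toMeasurable μ E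
  have hint : Integrable (fun ω => B + (toMeasurable μ E).indicator (fun _ => M) ω) μ :=
    (integrable_const B).add ((integrable_const M).indicator hmeas)
  calc ∫ ω, f ω ∂μ ≤ ∫ ω, B + (toMeasurable μ E).indicator (fun _ => M) ω ∂μ := by
        refine integral_mono hf hint fun ω => ?_
        by_cases hω : ω ∈ toMeasurable μ E
        · simp only [Set.indicator_of_mem hω]
          linarith [hall ω]
        · simp only [Set.indicator_of_notMem hω, add_zero]
          exact hgood ω fun h => hω (subset_toMeasurable μ E h)
    _ = B + μ.real E * M := by
        rw [integral_add (integrable_const B) ((integrable_const M).indicator hmeas),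
          integral_indicator_const _ hmeas]
        simp [Measure.real, measure_toMeasurable]
    _ ≤ B + ε * M := by
        have : μ.real E ≤ ε := ENNReal.toReal_le_of_le_ofReal hε hE
        gcongr

theorem integrable_totalSpread [IsProbabilityMeasure μ] (hw : ∀ t, Measurable (w t)) (T : ℕ) :
    Integrable (totalSpread P
      (fun t ω => seedSet P oracle X c lam σ (fun s => w s ω) t) T) μ := by
  have : Nonempty Ω := nonempty_of_isProbabilityMeasure μ
  have hdep : DependsOnPast P.diffusion w T (totalSpread P
      (fun t ω => seedSet P oracle X c lam σ (fun s => w s ω) t) T) := by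
    intro ω ω' h
    unfold totalSpread
    refine Finset.sum_congr rfl fun t ht => ?_
    have := (dependsOnPast_seedSet P oracle X c lam σ w t).mono (Finset.mem_range.1 ht).le ω ω' h
    exact congrArg P.diffusion.spread this
  refine Integrable.of_mem_Icc 0 (T * n) (hdep.measurable hw).aemeasurable
    (Filter.Eventually.of_forall fun ω => ⟨Finset.sum_nonneg fun t _ => spread_nonneg _, ?_⟩)
  calc _ ≤ ∑ _t ∈ Finset.range T, (n : ℝ) := Finset.sum_le_sum fun t _ => spread_le _
    _ = T * n := by simp

/-- The regret bound from an exceptional set outside which the confidence intervals are valid. -/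
theorem scaledRegret_le [IsProbabilityMeasure μ] (hmono : P.diffusion.IsMonotone)
    {Sstar Stilde : Finset (Fin n)} (hSt : Stilde ∈ P.feasible) {ρ : ℝ} (hρ : 0 < ρ)
    (hρF : ρ * P.diffusion.spread Sstar = surrogate Stilde P.diffusion.pairwiseReach)
    {θ : Fin n → EuclideanSpace ℝ (Fin d)}
    (hlin : ∀ u v, P.diffusion.pairwiseReach u v = inner ℝ (θ u) (feature X v))
    {α : ℝ} (hα_pos : 0 < α) (hα_le : α ≤ 1)
    (horacle : IsApproxOracle oracle P.graph P.feasible α)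
    (hlam : 0 < lam) (hσ : 0 < σ) {Θ : ℝ} (hΘ : ∀ u, ‖θ u‖ ≤ Θ) (hΘ0 : 0 ≤ Θ)
    (hc : Real.sqrt lam * Θ ≤ c) (hw : ∀ t, Measurable (w t)) {K T : ℕ}
    (hK : ∀ S ∈ P.feasible, S.card ≤ K) {Q ε : ℝ}
    (hQ : ∀ M ≤ T, ∑ j ∈ Finset.range M, ∑ v, widthSq X (lam * σ ^ 2) j v ≤ Q) (hε : 0 ≤ ε)
    (hE : μ {ω | ∃ t < T, ¬ IsConfident P oracle X c lam σ (fun s => w s ω) θ t} ≤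
      ENNReal.ofReal ε) :
    scaledRegret P μ (fun t ω => seedSet P oracle X c lam σ (fun s => w s ω) t) Sstar (ρ * α) T ≤
      2 * c / (ρ * α) * (σ * Real.sqrt (T * K * n * (n * Q))) +
        ε * (T * P.diffusion.spread Sstar) := by
  have hc0 : 0 ≤ c := (mul_nonneg (Real.sqrt_nonneg _) hΘ0).trans hc
  have hκ : 0 < ρ * α := mul_pos hρ hα_pos
  have hint : Integrable (totalSpread P
      (fun t ω => seedSet P oracle X c lam σ (fun s => w s ω) t) T) μ :=
    integrable_totalSpread hw T
  have hF0 := spread_nonneg (D := P.diffusion) Sstar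
  have heq : scaledRegret P μ (fun t ω => seedSet P oracle X c lam σ (fun s => w s ω) t) Sstar
      (ρ * α) T = ∫ ω, (T * P.diffusion.spread Sstar - 1 / (ρ * α) * totalSpread P
        (fun t ω => seedSet P oracle X c lam σ (fun s => w s ω) t) T ω) ∂μ := by
    rw [integral_sub (integrable_const _) (hint.const_mul _), integral_const,
      integral_const_mul, probReal_univ, one_smul]
    rfl
  rw [heq]
  refine integral_le_of_exceptional ((integrable_const _).sub (hint.const_mul _)) (by positivity)
    (by positivity) hε hE ?_ ?_
  · intro ω hω
    simp only [Set.mem_ofPred_eq, not_exists, not_and, not_not] at hω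
    have h1 : ∑ t ∈ Finset.range T, (ρ * α * P.diffusion.spread Sstar -
        P.diffusion.spread (seedSet P oracle X c lam σ (fun s => w s ω) t)) ≤
        2 * c * (σ * Real.sqrt (T * K * n * (n * Q))) := by
      refine (Finset.sum_le_sum fun t ht => round_regret_le hmono hSt hρF hlin hα_pos hα_le
        horacle hlam hσ hΘ hΘ0 hc (hω t (Finset.mem_range.1 ht))).trans ?_
      rw [← Finset.mul_sum]
      refine mul_le_mul_of_nonneg_left (sum_width_le hlam hσ (fun t _ => ?_) hQ) (by positivity)
      exact hK _ (horacle _ (stateAfter_ucb_mem_Icc P oracle X c lam σ _ t)).1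
    rw [Finset.sum_sub_distrib, Finset.sum_const, Finset.card_range, nsmul_eq_mul] at h1
    have h2 : T * P.diffusion.spread Sstar - 1 / (ρ * α) * totalSpread P
        (fun t ω => seedSet P oracle X c lam σ (fun s => w s ω) t) T ω =
        (T * (ρ * α * P.diffusion.spread Sstar) - totalSpread P
        (fun t ω => seedSet P oracle X c lam σ (fun s => w s ω) t) T ω) / (ρ * α) := by
      field_simp
    change T * P.diffusion.spread Sstar - 1 / (ρ * α) * totalSpread P _ T ω ≤ _
    rw [h2, div_mul_eq_mul_div]
    exact div_le_div_of_nonneg_right h1 hκ.le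
  · intro ω
    have : 0 ≤ totalSpread P
        (fun t ω => seedSet P oracle X c lam σ (fun s => w s ω) t) T ω :=
      Finset.sum_nonneg fun t _ => spread_nonneg _
    have h2 : 0 ≤ 1 / (ρ * α) * totalSpread P
        (fun t ω => seedSet P oracle X c lam σ (fun s => w s ω) t) T ω := by positivity
    exact sub_le_self _ h2

theorem noise_congr {D : DiffusionModel n W} {z z' : W} (h : pattern D z = pattern D z')
    (u : Fin n) : noise D u z = noise D u z' := by
  funext v
  rw [noise, noise, reach_congr D h]

theorem sumBefore_coord (A : ℕ → Prop) (x : ℕ → Fin n → ℝ) (t : ℕ) (i : Fin d) :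
    sumBefore A (fun s i => coord X (X.mulVec (x s)) i) t i =
      coord X (X.mulVec (sumBefore A x t)) i := by
  induction t with
  | zero => simp [sumBefore, coord]
  | succ t ih =>
    rw [sumBefore_succ, sumBefore_succ]
    split_ifs
    · rw [Pi.add_apply, ih, Matrix.mulVec_add, coord_add]
    · exact ih

theorem sumBefore_apply (A : ℕ → Prop) (x : ℕ → Fin n → ℝ) (t : ℕ) (v : Fin n) :
    sumBefore A (fun s (_ : Unit) => x s v) t () = sumBefore A x t v := by
  induction t with
  | zero => simp [sumBefore]
  | succ t ih =>
    rw [sumBefore_succ, sumBefore_succ]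
    split_ifs
    · rw [Pi.add_apply, ih, Pi.add_apply]
    · exact ih

theorem measurable_coord_noise (D : DiffusionModel n W) (u : Fin n) :
    Measurable fun z i => coord X (X.mulVec (noise D u z)) i := by
  refine measurable_pi_lambda _ fun i => ?_
  simp_rw [coord_mulVec]
  exact Finset.measurable_sum _ fun v _ => (measurable_noise D u v).mul_const _

theorem measure_biUnion_univ_le {E : Fin n → Set Ω} {δ : ℝ}
    (h : ∀ u, μ (E u) ≤ ENNReal.ofReal δ) :
    μ (⋃ u, E u) ≤ ENNReal.ofReal (n * δ) := by
  refine (measure_iUnion_fintype_le μ E).trans ((Finset.sum_le_sum fun u _ => h u).trans ?_)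
  rw [Finset.sum_const, Finset.card_univ, Fintype.card_fin, nsmul_eq_mul,
    ENNReal.ofReal_mul (Nat.cast_nonneg n), ENNReal.ofReal_natCast]

theorem isConfident_of_le (hσ : 0 < σ) {θ : Fin n → EuclideanSpace ℝ (Fin d)}
    {A Θ : ℝ} (hc : 1 / σ * A + Real.sqrt lam * Θ ≤ c) {z : ℕ → W} {t : ℕ}
    (hlam : 0 < lam)
    (h : ∀ u v, |estimationError P oracle X c lam σ z θ t u v| ≤
      (A + Real.sqrt (lam * σ ^ 2) * Θ) *
        Real.sqrt (widthSq X (lam * σ ^ 2) (plays P oracle X c lam σ z t u) v)) :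
    IsConfident P oracle X c lam σ z θ t := by
  intro u v
  refine (h u v).trans ?_
  rw [width, ← mul_assoc]
  refine mul_le_mul_of_nonneg_right ?_ (Real.sqrt_nonneg _)
  rw [Real.sqrt_mul hlam.le, Real.sqrt_sq hσ.le]
  have := mul_le_mul_of_nonneg_right hc hσ.le
  have h2 : (1 / σ * A + Real.sqrt lam * Θ) * σ = A + Real.sqrt lam * σ * Θ := by
    field_simp
  linarith

variable (oracle) in
/-- With high probability, all the confidence intervals are valid at all times. -/
theorem measure_exists_not_isConfident_le [IsProbabilityMeasure μ] (hn : 0 < n) (hd : 0 < d)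
    (hX : ∀ v, ‖feature X v‖ ≤ 1) {θ : Fin n → EuclideanSpace ℝ (Fin d)}
    (hlam : 0 < lam) (hσ : 0 < σ) {Θ : ℝ} (hΘ : ∀ u, ‖θ u‖ ≤ Θ) (hΘ0 : 0 ≤ Θ)
    (hw : ∀ t, Measurable (w t)) (hlaw : ∀ t, μ.map (w t) = P.diffusion.law)
    (hind : iIndepFun w μ) {T : ℕ} {ℓ : ℝ} (hℓ : 0 ≤ ℓ)
    (hc : 1 / σ * Real.sqrt (d * n * Real.log (1 + n * T / (d * (lam * σ ^ 2))) + 2 * ℓ) +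
      Real.sqrt lam * Θ ≤ c) :
    μ {ω | ∃ t < T, ¬ IsConfident P oracle X c lam σ (fun s => w s ω) θ t} ≤
      ENNReal.ofReal (n * Real.exp (-(3 / 2 * (d * Real.log (1 + n * T / (d * (lam * σ ^ 2)))) +
        4 / n * ℓ))) := by
  have hm : 0 < lam * σ ^ 2 := by positivity
  have hn' : (0 : ℝ) < n := by exact_mod_cast hn
  set m := lam * σ ^ 2 with hmdef
  set L := Real.log (1 + n * T / (d * m)) with hL
  have hL0 : 0 ≤ L := Real.log_nonneg (by
    have : (0 : ℝ) ≤ n * T / (d * m) := by positivity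
    linarith)
  -- The level q = (3/2) dL + (4/n) ℓ solves (n/4)(2q + dL) = dnL + 2ℓ, the squared radius allowed
  -- by c.
  refine le_trans (measure_mono ?_) (measure_biUnion_univ_le fun u =>
    measure_exists_lt_sum_sq_div_le (D := P.diffusion) hw hlaw hind
      (dependsOnPast_mem_seedSet P oracle X c lam σ w u)
      (measurable_coord_noise P.diffusion u)
      (fun z z' h => by rw [noise_congr h]) (R := (n : ℝ) / 4) (m := m) (ν := eigval X)
      (by positivity) hm (eigval_nonneg X) (lintegral_exp_coord_noise_le P.diffusion X u)
      (3 / 2 * (d * L) + 4 / n * ℓ) T)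
  rintro ω ⟨t, ht, hcon⟩
  rw [Set.mem_iUnion]
  by_contra hno
  push Not at hno
  refine hcon (isConfident_of_le hσ hc hlam fun u v => ?_)
  refine abs_sum_coord_le X hm (Real.sqrt_nonneg _) hΘ0 ?_ ?_ v
  · have h1 := hno u
    simp only [Set.mem_ofPred_eq, not_exists, not_and, not_lt] at h1
    have h2 := h1 t ht.le
    simp_rw [sumBefore_coord] at h2
    refine (show _ ≤ _ from h2).trans ?_
    have h3 := sum_log_eigval_le X hd hm hX
      ((countBefore_le (fun s => u ∈ seedSet P oracle X c lam σ (fun s => w s ω) s) t).trans ht.le)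
    rw [Real.sq_sqrt (by positivity)]
    calc _ ≤ (n : ℝ) / 4 * (2 * (3 / 2 * (d * L) + 4 / n * ℓ) + d * L) := by gcongr
      _ = d * n * L + 2 * ℓ := by field_simp; ring
  · rw [sum_coord_sq]
    exact pow_le_pow_left₀ (norm_nonneg _) (hΘ u) 2

end Regret

/-! ### The tabular case -/

section Tabular

variable {n : ℕ} {W Ω : Type*} [MeasurableSpace W] [MeasurableSpace Ω] {P : IMProblem n W}
  {oracle : Oracle n} {c lam σ : ℝ} {w : ℕ → Ω → W} {μ : Measure Ω}

theorem eigval_one (i : Fin n) : eigval (1 : Matrix (Fin n) (Fin n) ℝ) i = 1 := by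
  rw [← sum_coord_feature_sq]
  have h : ∀ v, coord (1 : Matrix (Fin n) (Fin n) ℝ)
      (fun k => (1 : Matrix (Fin n) (Fin n) ℝ) k v) i = (eigvec (1 : Matrix (Fin n) (Fin n) ℝ) i).ofLp v := by
    intro v
    simp [coord, dotProduct, Matrix.one_apply]
  simp_rw [h]
  rw [← EuclideanSpace.real_norm_sq_eq]
  simp [eigvec]

variable (oracle) in
/-- In the tabular case, each confidence interval only involves one coordinate of the feedback. -/
theorem measure_exists_not_isConfident_tabular_le [IsProbabilityMeasure μ] (hn : 0 < n)
    {θ : Fin n → EuclideanSpace ℝ (Fin n)}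
    (hlam : 0 < lam) (hσ : 0 < σ) {Θ : ℝ} (hΘ : ∀ u, ‖θ u‖ ≤ Θ) (hΘ0 : 0 ≤ Θ)
    (hw : ∀ t, Measurable (w t)) (hlaw : ∀ t, μ.map (w t) = P.diffusion.law)
    (hind : iIndepFun w μ) {T : ℕ} (hT : 0 < T)
    (hc : 1 / σ * Real.sqrt (n * n * Real.log (1 + n * T / (n * (lam * σ ^ 2))) +
      2 * Real.log ((n : ℝ) ^ 2 * T)) + Real.sqrt lam * Θ ≤ c) :
    μ {ω | ∃ t < T, ¬ IsConfident P oracle (1 : Matrix (Fin n) (Fin n) ℝ) c lam σ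
      (fun s => w s ω) θ t} ≤ ENNReal.ofReal (1 / (n * T)) := by
  have hm : 0 < lam * σ ^ 2 := by positivity
  have hn1 : (1 : ℝ) ≤ n := by exact_mod_cast hn
  have hT1 : (1 : ℝ) ≤ T := by exact_mod_cast hT
  set m := lam * σ ^ 2 with hmdef
  have hLeq : (1 : ℝ) + n * T / (n * m) = 1 + T / m := by
    rw [mul_div_mul_left _ _ (by positivity)]
  rw [hLeq] at hc
  set L := Real.log (1 + T / m) with hL
  have hL0 : 0 ≤ L := Real.log_nonneg (by
    have : (0 : ℝ) ≤ T / m := by positivity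
    linarith)
  have hlogn : 0 ≤ Real.log n := Real.log_nonneg hn1
  have hlogT : 0 ≤ Real.log T := Real.log_nonneg hT1
  have h2T : Real.log ((n : ℝ) ^ 2 * T) = 2 * Real.log n + Real.log T := by
    rw [Real.log_mul (by positivity) (by positivity), Real.log_pow]
    norm_num
  have h3T : Real.log ((n : ℝ) ^ 3 * T) = 3 * Real.log n + Real.log T := by
    rw [Real.log_mul (by positivity) (by positivity), Real.log_pow]
    norm_num
  -- Each pair may fail with probability 1/(n³T), and the union bound runs over n² pairs.
  have hδ : (1 : ℝ) / (n * T) = n * (n * Real.exp (-Real.log ((n : ℝ) ^ 3 * T))) := by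
    rw [Real.exp_neg, Real.exp_log (by positivity)]
    field_simp
  rw [hδ]
  refine le_trans (measure_mono ?_) (measure_biUnion_univ_le fun u => measure_biUnion_univ_le
    fun v => measure_exists_lt_sum_sq_div_le (D := P.diffusion) hw hlaw hind
      (dependsOnPast_mem_seedSet P oracle (1 : Matrix (Fin n) (Fin n) ℝ) c lam σ w u)
      (measurable_pi_lambda (fun z (_ : Unit) => noise P.diffusion u z v)
        fun _ => measurable_noise P.diffusion u v)
      (fun z z' h => by rw [noise_congr h]) (R := (1 : ℝ) / 4) (m := m) (ν := fun _ => 1)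
      (by positivity) hm (fun _ => zero_le_one) (lintegral_exp_noise_le P.diffusion u v)
      (Real.log ((n : ℝ) ^ 3 * T)) T)
  rintro ω ⟨t, ht, hcon⟩
  rw [Set.mem_iUnion]
  by_contra hno
  push Not at hno
  refine hcon (isConfident_of_le hσ hc hlam fun u v => ?_)
  have h1 := hno u
  rw [Set.mem_iUnion] at h1
  push Not at h1
  have h2 := h1 v
  simp only [Set.mem_ofPred_eq, not_exists, not_and, not_lt] at h2
  have h3 := h2 t ht.le
  simp only [sumBefore_apply (fun s => u ∈ seedSet P oracle 1 c lam σ (fun s => w s ω) s)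
    (fun s => noise P.diffusion u (w s ω)), Finset.univ_unique, Finset.sum_singleton,
    mul_one] at h3
  set N := plays P oracle (1 : Matrix (Fin n) (Fin n) ℝ) c lam σ (fun s => w s ω) t u with hN
  set s := noiseSum P oracle (1 : Matrix (Fin n) (Fin n) ℝ) c lam σ (fun s => w s ω) t u with hs
  change s v ^ 2 / (m + N) ≤ 1 / 4 * (2 * Real.log ((n : ℝ) ^ 3 * T) + Real.log (1 + N / m))
    at h3
  have hNT : (N : ℝ) ≤ T := by exact_mod_cast (countBefore_le _ t).trans ht.le
  have hlogN : Real.log (1 + N / m) ≤ L := by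
    rw [hL]
    gcongr
  have hdot : ∀ y : Fin n → ℝ, ∑ i, coord (1 : Matrix (Fin n) (Fin n) ℝ)
      (fun k => (1 : Matrix (Fin n) (Fin n) ℝ) k v) i * coord (1 : Matrix (Fin n) (Fin n) ℝ) y i = y v := by
    intro y
    rw [← dotProduct_eq_sum_coord]
    simp [dotProduct, Matrix.one_apply]
  -- For X = 1 only coordinate v of the noise enters, so the other coordinates may be set to 0
  -- before the self-normalized bound is applied.
  have herr : estimationError P oracle (1 : Matrix (Fin n) (Fin n) ℝ) c lam σ (fun s => w s ω) θ
      t u v = ∑ i, coord (1 : Matrix (Fin n) (Fin n) ℝ)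
      (fun k => (1 : Matrix (Fin n) (Fin n) ℝ) k v) i *
        ((coord (1 : Matrix (Fin n) (Fin n) ℝ) (Pi.single v (s v)) i -
          m * coord (1 : Matrix (Fin n) (Fin n) ℝ) (θ u).ofLp i) /
          (m + N * eigval (1 : Matrix (Fin n) (Fin n) ℝ) i)) := by
    simp only [estimationError, eigval_one, Matrix.one_mulVec, ← mul_div_assoc, ← Finset.sum_div,
      mul_sub, Finset.sum_sub_distrib]
    rw [hdot, hdot, Pi.single_eq_same]
  rw [herr]
  refine abs_sum_coord_le _ hm (Real.sqrt_nonneg _) hΘ0 ?_ ?_ v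
  · simp only [eigval_one, mul_one, ← Finset.sum_div]
    have hsq : ∑ i, coord (1 : Matrix (Fin n) (Fin n) ℝ) (Pi.single v (s v)) i ^ 2 = s v ^ 2 := by
      simp_rw [sq, ← dotProduct_eq_sum_coord]
      simp
    rw [hsq, Real.sq_sqrt (by rw [h2T]; positivity)]
    refine h3.trans ?_
    rw [h2T, h3T]
    have hnn : (1 : ℝ) ≤ n * n := by nlinarith
    have := mul_le_mul_of_nonneg_right hnn hL0
    linarith
  · rw [sum_coord_sq]
    exact pow_le_pow_left₀ (norm_nonneg _) (hΘ u) 2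

end Tabular

end IMBandit

namespace IMBandit

/-! ### Absorbing the failure cost -/

section Rates

/-- With x = 1/m ≤ 1 this reduces to (1 + x)⁴ ≤ (1 + 2x)³. -/
theorem four_mul_log_le {m : ℝ} (hm : 1 < m) {n : ℝ} (hn : 2 ≤ n) :
    4 * Real.log (1 + 1 / m) ≤ 3 * Real.log (1 + n / m) := by
  have hm0 : 0 < m := by linarith
  set x := 1 / m with hx
  have hx0 : 0 < x := by positivity
  have hx1 : x ≤ 1 := by rw [hx, div_le_one hm0]; exact hm.le
  have h1 : (4 : ℝ) * Real.log (1 + x) = Real.log ((1 + x) ^ 4) := by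
    rw [Real.log_pow]; norm_num
  have h2 : (3 : ℝ) * Real.log (1 + n / m) = Real.log ((1 + n / m) ^ 3) := by
    rw [Real.log_pow]; norm_num
  rw [h1, h2]
  refine Real.log_le_log (by positivity) ?_
  have h3 : (1 + 2 * x) ^ 3 ≤ (1 + n / m) ^ 3 := by
    have : 2 * x ≤ n / m := by rw [hx, mul_one_div]; gcongr
    gcongr
  refine le_trans ?_ h3
  have hx3 : x ^ 4 ≤ x := by
    calc x ^ 4 ≤ x ^ 1 := pow_le_pow_of_le_one hx0.le hx1 (by norm_num)
      _ = x := pow_one x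
  nlinarith [pow_pos hx0 2, pow_pos hx0 3]

theorem div_one_add_le_log {y : ℝ} (hy : 0 ≤ y) : y / (1 + y) ≤ Real.log (1 + y) := by
  have h := Real.one_sub_inv_le_log_of_pos (by linarith : 0 < 1 + y)
  have h2 : 1 - (1 + y)⁻¹ = y / (1 + y) := by
    have : 1 + y ≠ 0 := by linarith
    field_simp
    ring
  linarith

/-- In the regime where the regret bound is not trivial, the contribution of the failure of the
confidence intervals is absorbed by the gap between the two elliptical potential constants. -/
theorem failure_cost_le {n T : ℕ} {m D E Θ : ℝ} (hn : 2 ≤ n) (hT : 0 < T) (hm : 0 < m)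
    (hE : 0 ≤ E) (hΘ : 0 ≤ Θ)
    (hD : Real.log (1 + n * T / m) ≤ D)
    (hED : E ^ 2 * (1 + n * T / m) ^ 3 ≤ 1)
    (hsmall : 4 * n * D < T * Real.log (1 + 1 / m)) :
    n ^ 2 * T * Θ * E ≤
      1 / 8 * (2 * Θ * (Real.sqrt (n ^ 3) * Real.sqrt (T * D / Real.log (1 + 1 / m)))) := by
  have hn2 : (2 : ℝ) ≤ n := by exact_mod_cast hn
  have hT0 : (0 : ℝ) < T := by exact_mod_cast hT
  have hn0 : (0 : ℝ) < n := by linarith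
  set Y : ℝ := n * T / m with hY
  have hY0 : 0 < Y := by positivity
  set l := Real.log (1 + 1 / m) with hl
  have hx : 0 < 1 / m := by positivity
  have hl0 : 0 < l := Real.log_pos (by linarith)
  have hlm : l ≤ 1 / m := by
    have := Real.log_le_sub_one_of_pos (by linarith : 0 < 1 + 1 / m)
    linarith
  have hYD : Y / (1 + Y) ≤ D := (div_one_add_le_log hY0.le).trans hD
  have hYeq : (T : ℝ) / m = Y / n := by rw [hY]; field_simp
  -- Since Y/(1 + Y) ≤ D and T l ≤ Y/n, the smallness hypothesis forces 4n² < 1 + Y.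
  have hY4 : 4 ≤ 1 + Y := by
    have h1 : 4 * n * (Y / (1 + Y)) < Y / n := by
      calc 4 * n * (Y / (1 + Y)) ≤ 4 * n * D := by gcongr
        _ < T * l := hsmall
        _ ≤ T * (1 / m) := by gcongr
        _ = Y / n := by rw [← hYeq]; ring
    rw [lt_div_iff₀ hn0, ← mul_div_assoc, div_mul_eq_mul_div, div_lt_iff₀ (by linarith)] at h1
    have h2 : 4 * n * n < 1 + Y := by
      by_contra hcon
      have := mul_le_mul_of_nonneg_left (not_lt.1 hcon) hY0.le
      linarith
    nlinarith
  set r := Real.sqrt (1 + Y) with hr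
  have hr2 : r ^ 2 = 1 + Y := Real.sq_sqrt (by linarith)
  have hr0 : 0 < r := Real.sqrt_pos.2 (by linarith)
  have hEr : E * r ^ 3 ≤ 1 := by
    have h1 : (E * r ^ 3) ^ 2 ≤ 1 ^ 2 := by
      calc (E * r ^ 3) ^ 2 = E ^ 2 * (r ^ 2) ^ 3 := by ring
        _ ≤ 1 ^ 2 := by rw [hr2]; linarith
    exact (pow_le_pow_iff_left₀ (by positivity) zero_le_one two_ne_zero).1 h1
  -- Two of the three factors r are traded for r² ≥ 4.
  have hEr4 : E ≤ 1 / (4 * r) := by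
    rw [le_div_iff₀ (by positivity)]
    calc E * (4 * r) ≤ E * (r ^ 2 * r) := by rw [hr2]; gcongr
      _ = E * r ^ 3 := by ring
      _ ≤ 1 := hEr
  have hroot : n ^ 2 * T / r ≤ Real.sqrt (n ^ 3) * Real.sqrt (T * D / l) := by
    rw [← Real.sqrt_mul (by positivity)]
    refine Real.le_sqrt_of_sq_le ?_
    rw [div_pow, hr2, mul_div_assoc', le_div_iff₀ hl0]
    calc (n ^ 2 * T) ^ 2 / (1 + Y) * l ≤ (n ^ 2 * T) ^ 2 / (1 + Y) * (1 / m) := by gcongr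
      _ = n ^ 3 * (T * (Y / (1 + Y))) := by rw [hY]; field_simp
      _ ≤ n ^ 3 * (T * D) := by gcongr
  calc n ^ 2 * T * Θ * E ≤ n ^ 2 * T * Θ * (1 / (4 * r)) := by gcongr
    _ = 1 / 8 * (2 * Θ * (n ^ 2 * T / r)) := by field_simp; ring
    _ ≤ _ := by gcongr

/-- The final comparison of the rates. -/
theorem regret_rate_le {n K T : ℕ} {m lam D F ρ α c Θ Reg : ℝ}
    (hn : 0 < n) (hK : 0 < K) (hT : 0 < T) (hm : 0 < m) (hlam : 0 < lam)
    (hD : Real.log (1 + n * T / m) ≤ D)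
    (hFn : F ≤ n) (hρ : 0 < ρ) (hρ1 : ρ ≤ 1) (hρF : ρ * F ≤ n * Θ)
    (hα : 0 < α) (hα1 : α ≤ 1) (hΘ : 0 ≤ Θ) (hc : Real.sqrt lam * Θ ≤ c)
    (htriv : Reg ≤ T * F)
    (hReg : Reg ≤ 2 * c / (ρ * α) *
        (Real.sqrt (n ^ 3) * Real.sqrt (K * T * D / (lam * Real.log (1 + n / m)))) +
      n * Real.exp (-(3 / 2 * D + 4 / n * Real.log ((n : ℝ) ^ 2 * T))) * (T * F)) :
    Reg ≤ 2 * c / (ρ * α) *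
        (Real.sqrt (n ^ 3) * Real.sqrt (K * T * D / (lam * Real.log (1 + 1 / m)))) + 1 / ρ := by
  have hn1 : (1 : ℝ) ≤ n := by exact_mod_cast hn
  have hK1 : (1 : ℝ) ≤ K := by exact_mod_cast hK
  have hT1 : (1 : ℝ) ≤ T := by exact_mod_cast hT
  have hn0 : (0 : ℝ) < n := by linarith
  have hT0 : (0 : ℝ) < T := by linarith
  have hK0 : (0 : ℝ) < K := by linarith
  have hc0 : 0 ≤ c := (mul_nonneg (Real.sqrt_nonneg _) hΘ).trans hc
  set l := Real.log (1 + 1 / m) with hl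
  set ln := Real.log (1 + n / m) with hln
  have hx : 0 < 1 / m := by positivity
  have hl0 : 0 < l := Real.log_pos (by linarith)
  have hlln : l ≤ ln := by rw [hl, hln]; gcongr
  have hln0 : 0 < ln := hl0.trans_le hlln
  have hlD : l ≤ D := by
    refine le_trans ?_ hD
    have : (1 : ℝ) ≤ n * T := by nlinarith
    rw [hl]
    gcongr
  have hD0 : 0 < D := hl0.trans_le hlD
  have hκ : 0 < ρ * α := mul_pos hρ hα
  set B := 2 * c / (ρ * α) * (Real.sqrt (n ^ 3) * Real.sqrt (K * T * D / (lam * l))) with hB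
  have hB0 : 0 ≤ B := by positivity
  have hρinv : 1 ≤ 1 / ρ := by rw [le_div_iff₀ hρ]; linarith
  -- The trivial bound settles this case; from here on B < T F, which makes T large.
  by_cases hcase : T * F ≤ B
  · linarith
  push Not at hcase
  have hBlow : 2 * Θ * (Real.sqrt (n ^ 3) * Real.sqrt (T * D / l)) ≤ ρ * B := by
    have h1 : Θ * Real.sqrt (T * D / l) ≤ c / α * Real.sqrt (K * T * D / (lam * l)) := by
      have h2 : Θ ≤ c / α / Real.sqrt lam := by
        rw [le_div_iff₀ (Real.sqrt_pos.2 hlam), le_div_iff₀ hα]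
        have : Θ * Real.sqrt lam * α ≤ Θ * Real.sqrt lam :=
          mul_le_of_le_one_right (by positivity) hα1
        linarith
      have h3 : Real.sqrt (T * D / l) ≤
          Real.sqrt lam * Real.sqrt (K * T * D / (lam * l)) := by
        rw [← Real.sqrt_mul hlam.le]
        refine Real.sqrt_le_sqrt ?_
        have h4 : lam * (K * T * D / (lam * l)) = K * (T * D / l) := by field_simp
        rw [h4]
        exact le_mul_of_one_le_left (by positivity) hK1
      calc Θ * Real.sqrt (T * D / l) ≤ c / α / Real.sqrt lam *
            (Real.sqrt lam * Real.sqrt (K * T * D / (lam * l))) := by gcongr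
        _ = c / α * Real.sqrt (K * T * D / (lam * l)) := by
            have := (Real.sqrt_pos.2 hlam).ne'
            field_simp
    have h5 : ρ * B = 2 * (Real.sqrt (n ^ 3) *
        (c / α * Real.sqrt (K * T * D / (lam * l)))) := by
      rw [hB]; field_simp
    rw [h5]
    calc _ = 2 * (Real.sqrt (n ^ 3) * (Θ * Real.sqrt (T * D / l))) := by ring
      _ ≤ _ := by gcongr
  -- The lower bound on B, B < T F and ρF ≤ nΘ are compared; Θ cancels and squaring gives the claim.
  have hsmall : 4 * n * D < T * l := by
    have h1 : 2 * Θ * (Real.sqrt (n ^ 3) * Real.sqrt (T * D / l)) < T * (n * Θ) := by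
      calc _ ≤ ρ * B := hBlow
        _ < ρ * (T * F) := by gcongr
        _ = T * (ρ * F) := by ring
        _ ≤ T * (n * Θ) := by gcongr
    have hΘ0 : 0 < Θ := by
      rcases hΘ.eq_or_lt with h | h
      · rw [← h] at h1; simp at h1
      · exact h
    have h2 : 2 * (Real.sqrt (n ^ 3) * Real.sqrt (T * D / l)) < T * n := by
      by_contra hcon
      have := mul_le_mul_of_nonneg_left (not_lt.1 hcon) hΘ
      linarith
    rw [← Real.sqrt_mul (by positivity)] at h2
    have h3 : Real.sqrt (n ^ 3 * (T * D / l)) < T * n / 2 := by linarith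
    rw [Real.sqrt_lt' (by positivity)] at h3
    have h4 : (n : ℝ) ^ 3 * (T * D / l) = (4 * n * D) * (n ^ 2 * T / 4) / l := by
      field_simp
    have h5 : (T * n / 2 : ℝ) ^ 2 = (T * l) * (n ^ 2 * T / 4) / l := by
      field_simp; norm_num
    rw [h4, h5, div_lt_div_iff_of_pos_right hl0] at h3
    exact lt_of_mul_lt_mul_right h3 (by positivity)
  have h4nT : 4 * (n : ℝ) < T := by
    have h1 : 4 * n * l < T * l := lt_of_le_of_lt (by gcongr) hsmall
    exact lt_of_mul_lt_mul_right h1 hl0.le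
  set E := Real.exp (-(3 / 2 * D + 4 / n * Real.log ((n : ℝ) ^ 2 * T))) with hE
  have hE0 : 0 < E := Real.exp_pos _
  have hlog0 : 0 ≤ Real.log ((n : ℝ) ^ 2 * T) := Real.log_nonneg (by nlinarith)
  set M := 2 * c / (ρ * α) * (Real.sqrt (n ^ 3) * Real.sqrt (K * T * D / (lam * ln))) with hM
  -- The failure cost is at most n²TE, so here it is covered by 1 ≤ 1/ρ.
  by_cases hEcase : n ^ 2 * T * E ≤ 1
  · have h1 : M ≤ B := by
      rw [hM, hB]
      gcongr
    have h2 : n * E * (T * F) ≤ 1 := by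
      calc n * E * (T * F) ≤ n * E * (T * n) := by gcongr
        _ = n ^ 2 * T * E := by ring
        _ ≤ 1 := hEcase
    linarith
  push Not at hEcase
  have hY0 : (0 : ℝ) < n * T / m := by positivity
  have hED : E ^ 2 * (1 + n * T / m) ^ 3 ≤ 1 := by
    have h1 : (1 + n * T / m) ^ 3 = Real.exp (3 * Real.log (1 + n * T / m)) := by
      rw [← Real.exp_log (by linarith : (0 : ℝ) < 1 + n * T / m), ← Real.exp_nat_mul,
        Real.log_exp]
      norm_num
    rw [h1, hE, ← Real.exp_nat_mul, ← Real.exp_add, Real.exp_le_one_iff]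
    have : 0 ≤ 4 / n * Real.log ((n : ℝ) ^ 2 * T) := by positivity
    push_cast
    linarith
  -- For n = 1 the coefficient 4/n already gives E ≤ 1/T, contradicting `hEcase`.
  have hn2 : 2 ≤ n := by
    by_contra hcon
    have hn_one : n = 1 := by omega
    subst hn_one
    have h1 : E ≤ (T : ℝ)⁻¹ := by
      rw [← Real.exp_log hT0, ← Real.exp_neg, hE, Real.exp_le_exp]
      have : 0 ≤ Real.log T := Real.log_nonneg hT1
      simp only [Nat.cast_one, one_pow, one_mul, div_one]
      linarith
    have h2 := mul_le_mul_of_nonneg_left h1 hT0.le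
    rw [mul_inv_cancel₀ hT0.ne'] at h2
    simp only [Nat.cast_one, one_pow, one_mul] at hEcase
    linarith
  -- If m ≤ 1 then nT ≤ nT/m, and `hED` together with `hEcase` yields T < n, against 4n < T.
  have hm1 : 1 < m := by
    by_contra hcon
    have hYnT : (n * T : ℝ) ≤ n * T / m := le_div_self (by positivity) hm (not_lt.1 hcon)
    have h1 : (n * T : ℝ) ^ 3 * E ^ 2 ≤ 1 := by
      refine le_trans ?_ hED
      rw [mul_comm]
      gcongr
      linarith
    have h2 : 1 < (n ^ 2 * T * E) ^ 2 := one_lt_pow₀ hEcase two_ne_zero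
    have h3 : (n * T : ℝ) ^ 3 * E ^ 2 < (n ^ 2 * T * E) ^ 2 := by linarith
    have h4 : (n * T : ℝ) ^ 3 * E ^ 2 = T * (n ^ 3 * T ^ 2 * E ^ 2) := by ring
    have h5 : (n ^ 2 * T * E) ^ 2 = n * (n ^ 3 * T ^ 2 * E ^ 2) := by ring
    rw [h4, h5] at h3
    have := lt_of_mul_lt_mul_right h3 (by positivity)
    linarith
  have hcost := failure_cost_le hn2 hT hm hE0.le hΘ hD hED hsmall
  have hcost2 : n * E * (T * F) ≤ 1 / 8 * B := by
    have h1 : ρ * (n * E * (T * F)) ≤ ρ * (1 / 8 * B) := by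
      calc ρ * (n * E * (T * F)) = n * E * T * (ρ * F) := by ring
        _ ≤ n * E * T * (n * Θ) := by gcongr
        _ = n ^ 2 * T * Θ * E := by ring
        _ ≤ _ := hcost
        _ ≤ 1 / 8 * (ρ * B) := by gcongr
        _ = ρ * (1 / 8 * B) := by ring
    exact le_of_mul_le_mul_left h1 hρ
  -- The ratio of the two logarithms is at most 3/4, below (7/8)² = 49/64.
  have hMB : M ≤ 7 / 8 * B := by
    have h1 : Real.sqrt (K * T * D / (lam * ln)) ≤
        7 / 8 * Real.sqrt (K * T * D / (lam * l)) := by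
      have h2 : (7 / 8 : ℝ) = Real.sqrt ((7 / 8) ^ 2) := (Real.sqrt_sq (by norm_num)).symm
      rw [h2, ← Real.sqrt_mul (by positivity)]
      refine Real.sqrt_le_sqrt ?_
      have h3 := four_mul_log_le hm1 (n := n) (by exact_mod_cast hn2)
      have h4 : (7 / 8 : ℝ) ^ 2 * (K * T * D / (lam * l)) =
          K * T * D / (lam * ((64 / 49) * l)) := by field_simp; norm_num
      rw [h4]
      have h5 : 64 / 49 * l ≤ ln := by linarith
      gcongr
    calc M ≤ 2 * c / (ρ * α) * (Real.sqrt (n ^ 3) *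
          (7 / 8 * Real.sqrt (K * T * D / (lam * l)))) := by rw [hM]; gcongr
      _ = 7 / 8 * B := by rw [hB]; ring
  have : 0 < 1 / ρ := by positivity
  linarith

end Rates

end IMBandit

namespace IMBandit

/-! ### Assembly of the theorem -/

section Assembly

variable {n d : ℕ} {W Ω : Type*} [MeasurableSpace W] [MeasurableSpace Ω] {P : IMProblem n W}

theorem scaledRegret_le_mul_spread {μ : Measure Ω} {S : ℕ → Ω → Finset (Fin n)}
    {Sstar : Finset (Fin n)} {κ : ℝ} (hκ : 0 < κ) (T : ℕ) :
    scaledRegret P μ S Sstar κ T ≤ T * P.diffusion.spread Sstar := by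
  have h : 0 ≤ ∫ ω, totalSpread P S T ω ∂μ :=
    integral_nonneg fun ω => Finset.sum_nonneg fun t _ => spread_nonneg _
  exact sub_le_self _ (by positivity)

theorem surrogate_pairwiseReach_le {X : Matrix (Fin d) (Fin n) ℝ}
    (hX : ∀ v, ‖feature X v‖ ≤ 1) {θ : Fin n → EuclideanSpace ℝ (Fin d)}
    (hlin : ∀ u v, P.diffusion.pairwiseReach u v = inner ℝ (θ u) (feature X v)) {Θ : ℝ}
    (hΘ : ∀ u, ‖θ u‖ ≤ Θ) (hΘ0 : 0 ≤ Θ) (S : Finset (Fin n)) :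
    surrogate S P.diffusion.pairwiseReach ≤ n * Θ := by
  refine (surrogate_le_sum (g := fun _ => Θ) (fun _ => hΘ0) fun u _ v => ?_).trans (by simp)
  rw [hlin]
  exact (real_inner_le_norm _ _).trans
    ((mul_le_of_le_one_right (norm_nonneg _) (hX v)).trans (hΘ u))

theorem sqrt_cube_eq_rpow (n : ℕ) : Real.sqrt ((n : ℝ) ^ 3) = (n : ℝ) ^ (3 / 2 : ℝ) := by
  rw [Real.sqrt_eq_rpow, ← Real.rpow_natCast, ← Real.rpow_mul (Nat.cast_nonneg n)]
  norm_num

theorem mul_sqrt_width_eq {K T lam σ D l : ℝ} (hlam : 0 < lam) (hσ : 0 < σ) :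
    σ * Real.sqrt (T * K * n * (n * (n / (lam * σ ^ 2) * D / l))) =
      Real.sqrt ((n : ℝ) ^ 3) * Real.sqrt (K * T * D / (lam * l)) := by
  rw [← Real.sqrt_mul (by positivity)]
  nth_rewrite 1 [← Real.sqrt_sq hσ.le]
  rw [← Real.sqrt_mul (sq_nonneg σ)]
  congr 1
  field_simp

end Assembly

end IMBandit

open IMBandit

theorem theorem2 {n d K T : ℕ} {W Ω : Type*} [MeasurableSpace W] [MeasurableSpace Ω]
    (P : IMBandit.IMProblem n W)
    (hK : K ≤ n) (hcard : ∀ S ∈ P.feasible, S.card ≤ K)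
    (hmono : P.diffusion.IsMonotone)
    -- an optimal seed set, a maximizer of the surrogate, and the surrogate approximation factor
    (Sstar Stilde : Finset (Fin n))
    (hSstar : IMBandit.IsArgmax P.feasible P.diffusion.spread Sstar)
    (hStilde : IMBandit.IsArgmax P.feasible
      (fun S => IMBandit.surrogate S P.diffusion.pairwiseReach) Stilde)
    (ρ : ℝ)
    (hρ : ρ = IMBandit.surrogate Stilde P.diffusion.pairwiseReach / P.diffusion.spread Sstar)
    (hρ_pos : 0 < ρ)
    -- features and perfect linear generalization
    (X : Matrix (Fin d) (Fin n) ℝ) (θ : Fin n → EuclideanSpace ℝ (Fin d))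
    (hlin : ∀ u v, P.diffusion.pairwiseReach u v = inner ℝ (θ u) (IMBandit.feature X v))
    (hX : ∀ v, ‖IMBandit.feature X v‖ ≤ 1)
    -- the oracle and the parameters of the algorithm
    (α : ℝ) (hα_pos : 0 < α) (hα_le : α ≤ 1) (oracle : IMBandit.Oracle n)
    (horacle : IMBandit.IsApproxOracle oracle P.graph P.feasible α)
    (lam σ c : ℝ) (hlam : 0 < lam) (hσ : 0 < σ)
    (hc : 1 / σ * Real.sqrt (d * n * Real.log (1 + n * T / (σ ^ 2 * lam * d))
        + 2 * Real.log ((n : ℝ) ^ 2 * T)) + Real.sqrt lam * (⨆ u, ‖θ u‖) ≤ c)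
    -- the independent diffusion random vectors of the successive rounds
    (μ : MeasureTheory.Measure Ω) [MeasureTheory.IsProbabilityMeasure μ] (w : ℕ → Ω → W)
    (hw_meas : ∀ t, Measurable (w t)) (hw_law : ∀ t, μ.map (w t) = P.diffusion.law)
    (hw_indep : ProbabilityTheory.iIndepFun w μ)
    -- the seed sets chosen by DILinUCB
    (S : ℕ → Ω → Finset (Fin n))
    (hS : ∀ t ω, S t ω = IMBandit.seedSet P oracle X c lam σ (fun s => w s ω) t) :
    MeasureTheory.Integrable (IMBandit.totalSpread P S T) μ ∧
    IMBandit.scaledRegret P μ S Sstar (ρ * α) T ≤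
      2 * c / (ρ * α) * (n : ℝ) ^ (3 / 2 : ℝ) *
        Real.sqrt (d * K * T * Real.log (1 + n * T / (d * lam * σ ^ 2)) /
          (lam * Real.log (1 + 1 / (lam * σ ^ 2)))) + 1 / ρ ∧
    -- the tabular case: `d = n` and `X` is the identity matrix
    (∀ hd : d = n, X.submatrix (Fin.cast hd.symm) id = 1 →
      IMBandit.scaledRegret P μ S Sstar (ρ * α) T ≤
        2 * c / (ρ * α) * (n : ℝ) ^ (3 / 2 : ℝ) *
          Real.sqrt (K * T * Real.log (1 + T / (lam * σ ^ 2)) /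
            (lam * Real.log (1 + 1 / (lam * σ ^ 2)))) + 1 / ρ) := by
  obtain rfl : S = fun t ω => seedSet P oracle X c lam σ (fun s => w s ω) t := by
    funext t ω
    exact hS t ω
  refine ⟨integrable_totalSpread hw_meas T, ?_⟩
  set F := P.diffusion.spread Sstar with hF
  set f := surrogate Stilde P.diffusion.pairwiseReach with hf
  set Θ := ⨆ u, ‖θ u‖ with hΘdef
  have hΘ : ∀ u, ‖θ u‖ ≤ Θ := fun u => le_ciSup (f := fun u => ‖θ u‖)
    (Set.finite_range _).bddAbove u
  have hΘ0 : 0 ≤ Θ := Real.iSup_nonneg fun u => norm_nonneg _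
  have hF0 : 0 ≤ F := spread_nonneg _
  -- If F = 0, division by zero would give ρ = 0.
  have hFpos : 0 < F := by
    rcases hF0.eq_or_lt with h | h
    · rw [hρ, ← h, div_zero] at hρ_pos
      exact absurd hρ_pos (lt_irrefl 0)
    · exact h
  have hρF : ρ * F = f := by rw [hρ, div_mul_cancel₀ _ hFpos.ne']
  have hfpos : 0 < f := hρF ▸ mul_pos hρ_pos hFpos
  have hρ1 : ρ ≤ 1 := by
    rw [hρ, div_le_one hFpos]
    exact (surrogate_le_spread hmono Stilde).trans (hSstar.2 Stilde hStilde.1)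
  have hn : 0 < n := by
    rcases Nat.eq_zero_or_pos n with h | h
    · subst h
      simp [hf, surrogate] at hfpos
    · exact h
  have hfΘ : f ≤ n * Θ := surrogate_pairwiseReach_le hX hlin hΘ hΘ0 Stilde
  -- In dimension 0 all weights vanish, so the surrogate optimum would be 0.
  have hd : 0 < d := by
    rcases Nat.eq_zero_or_pos d with h | h
    · subst h
      have h0 : Θ = 0 := by
        simp [hΘdef, Subsingleton.elim _ (0 : EuclideanSpace ℝ (Fin 0))]
      rw [h0, mul_zero] at hfΘ
      exact absurd hfpos (not_lt.2 hfΘ)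
    · exact h
  have hKpos : 0 < K := by
    have hne : Stilde.Nonempty := by
      by_contra hcon
      simp [hf, surrogate, hcon] at hfpos
    exact (Finset.card_pos.2 hne).trans_le (hcard _ hStilde.1)
  have hm : 0 < lam * σ ^ 2 := by positivity
  have hκ : 0 < ρ * α := mul_pos hρ_pos hα_pos
  have hcΘ : Real.sqrt lam * Θ ≤ c := le_trans (le_add_of_nonneg_left (by positivity)) hc
  have hc0 : 0 ≤ c := (by positivity : 0 ≤ Real.sqrt lam * Θ).trans hcΘ
  have hn1 : (1 : ℝ) ≤ n := by exact_mod_cast hn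
  have htriv := scaledRegret_le_mul_spread (P := P) (μ := μ) (Sstar := Sstar)
    (S := fun t ω => seedSet P oracle X c lam σ (fun s => w s ω) t) hκ T
  -- With no rounds the regret is at most 0; this case is apart because log(n²T) is then a default
  -- value.
  rcases Nat.eq_zero_or_pos T with hT | hT
  · have h0 : ∀ B : ℝ, 0 ≤ B → scaledRegret P μ
        (fun t ω => seedSet P oracle X c lam σ (fun s => w s ω) t) Sstar (ρ * α) T ≤
          B + 1 / ρ := fun B hB => by
      have : (T : ℝ) * P.diffusion.spread Sstar = 0 := by rw [hT]; simp
      rw [this] at htriv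
      exact htriv.trans (by positivity)
    exact ⟨h0 _ (by positivity), fun _ _ => h0 _ (by positivity)⟩
  have hT1 : (1 : ℝ) ≤ T := by exact_mod_cast hT
  have hlog : 0 ≤ Real.log ((n : ℝ) ^ 2 * T) :=
    Real.log_nonneg (one_le_mul_of_one_le_of_one_le (one_le_pow₀ hn1) hT1)
  have hcomm : σ ^ 2 * lam * d = d * (lam * σ ^ 2) := by ring
  rw [hcomm] at hc
  constructor
  · set D := d * Real.log (1 + n * T / (d * (lam * σ ^ 2))) with hD
    have hprob := measure_exists_not_isConfident_le oracle hn hd hX hlam hσ hΘ hΘ0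
      hw_meas hw_law hw_indep hlog hc
    have hlnpos : 0 < Real.log (1 + n / (lam * σ ^ 2)) := by
      have : (0 : ℝ) < n / (lam * σ ^ 2) := by positivity
      exact Real.log_pos (by linarith)
    have hQ : ∀ M ≤ T, ∑ j ∈ Finset.range M, ∑ v, widthSq X (lam * σ ^ 2) j v ≤
        n / (lam * σ ^ 2) * D / Real.log (1 + n / (lam * σ ^ 2)) := by
      intro M hM
      rw [le_div_iff₀ hlnpos]
      refine (sum_range_sum_widthSq_le X hm
        (fun i => div_le_div_of_nonneg_right (eigval_le X hX i) hm.le) M).trans ?_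
      have := sum_log_eigval_le X hd hm hX hM
      gcongr
    have hreg := scaledRegret_le (μ := μ) hmono hStilde.1 hρ_pos hρF hlin hα_pos hα_le horacle
      hlam hσ hΘ hΘ0 hcΘ hw_meas hcard hQ (by positivity) hprob
    rw [mul_sqrt_width_eq hlam hσ] at hreg
    -- Bernoulli's inequality moves the dimension out of the logarithm.
    have hDlog : Real.log (1 + n * T / (lam * σ ^ 2)) ≤ D := by
      have h1 := log_one_add_le_nat_mul hd
        (by positivity : (0 : ℝ) ≤ n * T / (lam * σ ^ 2))
      rwa [div_div, mul_comm (lam * σ ^ 2)] at h1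
    have hrate := regret_rate_le hn hKpos hT hm hlam hDlog (spread_le Sstar) hρ_pos hρ1
      (hρF.trans_le hfΘ) hα_pos hα_le hΘ0 hcΘ htriv hreg
    refine hrate.trans (le_of_eq ?_)
    rw [sqrt_cube_eq_rpow, hD, mul_assoc (d : ℝ) lam, ← mul_assoc (2 * c / (ρ * α))]
    congr 4
    ring
  · intro hdn hXone
    subst hdn
    obtain rfl : X = 1 := hXone
    set L := Real.log (1 + T / (lam * σ ^ 2)) with hL
    have hprob := measure_exists_not_isConfident_tabular_le (P := P) oracle hn hlam hσ
      hΘ hΘ0 hw_meas hw_law hw_indep hT hc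
    have hlpos : 0 < Real.log (1 + 1 / (lam * σ ^ 2)) := by
      have : (0 : ℝ) < 1 / (lam * σ ^ 2) := by positivity
      exact Real.log_pos (by linarith)
    -- All eigenvalues being 1, the potential bound holds with e₀ = 1/m, so the claimed denominator
    -- appears directly.
    have hQ : ∀ M ≤ T, ∑ j ∈ Finset.range M, ∑ v,
        widthSq (1 : Matrix (Fin d) (Fin d) ℝ) (lam * σ ^ 2) j v ≤
        d / (lam * σ ^ 2) * L / Real.log (1 + 1 / (lam * σ ^ 2)) := by
      intro M hM
      rw [le_div_iff₀ hlpos]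
      refine (sum_range_sum_widthSq_le 1 hm (fun i => by rw [eigval_one]) M).trans ?_
      have hMT : (M : ℝ) ≤ T := by exact_mod_cast hM
      simp only [eigval_one, mul_one, Finset.sum_const, Finset.card_univ, Fintype.card_fin,
        nsmul_eq_mul]
      have h1 : Real.log (1 + M / (lam * σ ^ 2)) ≤ L := by
        rw [hL]
        gcongr
      calc 1 / (lam * σ ^ 2) * (d * Real.log (1 + M / (lam * σ ^ 2)))
          = d / (lam * σ ^ 2) * Real.log (1 + M / (lam * σ ^ 2)) := by ring
        _ ≤ d / (lam * σ ^ 2) * L := by gcongr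
    have hreg := scaledRegret_le (μ := μ) hmono hStilde.1 hρ_pos hρF hlin hα_pos hα_le horacle
      hlam hσ hΘ hΘ0 hcΘ hw_meas hcard hQ (by positivity) hprob
    rw [mul_sqrt_width_eq hlam hσ] at hreg
    refine hreg.trans ?_
    rw [sqrt_cube_eq_rpow, ← mul_assoc (2 * c / (ρ * α))]
    refine add_le_add le_rfl ?_
    have hFn : P.diffusion.spread Sstar ≤ d := spread_le Sstar
    calc 1 / (d * T : ℝ) * (T * P.diffusion.spread Sstar) ≤ 1 / (d * T : ℝ) * (T * d) := by
          gcongr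
      _ = 1 := by field_simp
      _ ≤ 1 / ρ := by rw [le_div_iff₀ hρ_pos, one_mul]; exact hρ1
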